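/- Call a real number $C$ \emph{admissible} if, for every $n$, all i.i.d. real random variables $X_1,\dots,X_n$ with a log-concave density symmetric about $0$, and all $\alpha,\beta\in\mathbb{R}^n$ with $\alpha\neq 0$, $$\mathbf{P}\Big\{\Big|\sum_{i=1}^n\alpha_iX_i\Big|\le\Big|\sum_{i=1}^n\beta_iX_i\Big|\Big\}\le C\,\frac{\|\beta\|}{\|\alpha\|},$$ where $\|\cdot\|$ is the Euclidean norm. Then an admissible constant exists, and for every admissible $C$ the following holds. Let $X_1,\dots,X_n$ be i.i.d. real random variables with a density $f$ that is symmetric about $0$ ($f(-t)=f(t)$ for all $t$) and unimodal (for some $m$, nondecreasing on $(-\infty,m)$ and nonincreasing on $(m,\infty)$), and let $B$ be a real number such that $$\int_{\mathbb{R}} t^2f(t)\,dt\le B\qquad\text{and}\qquad \int_0^1 t^{-3}\big[\mathbf{P}\{|X_1|\le t\}-2tf(t)\big]\,dt\le B.$$ Then for all $\alpha,\beta\in\mathbb{R}^n$ with $\alpha\ne0$, $$\mathbf{P}\Big\{\Big|\sum_{i=1}^n\alpha_iX_i\Big|\le\Big|\sum_{i=1}^n\beta_iX_i\Big|\Big\}\le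 12\,C\,B\,\frac{\|\beta\|}{\|\alpha\|}.$$ -/

import Mathlib

open MeasureTheory ProbabilityTheory Set

/-- A real function is unimodal if, for some mode `m`, it is nondecreasing to the left of `m` and
nonincreasing to the right of `m`. -/
def IsUnimodal (f : ℝ → ℝ) : Prop :=
  ∃ m : ℝ, MonotoneOn f (Iio m) ∧ AntitoneOn f (Ioi m)

/-- Log-concavity of a nonnegative function on the real line:
`f (a x + b y) ≥ f x ^ a * f y ^ b` for all convex weights `a, b`. -/
def IsLogConcave (f : ℝ → ℝ) : Prop :=
  ∀ x y a b : ℝ, 0 ≤ a → 0 ≤ b → a + b = 1 → f x ^ a * f y ^ b ≤ f (a * x + b * y)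

/-- The random variables `X i` are i.i.d. under `P`, their common law having the density `f` with
respect to Lebesgue measure. -/
structure IsIIDWithDensity {Ω : Type*} [MeasurableSpace Ω] (P : Measure Ω) {n : ℕ}
    (X : Fin n → Ω → ℝ) (f : ℝ → ℝ) : Prop where
  nonneg : ∀ t, 0 ≤ f t
  indep : iIndepFun X P
  law : ∀ i, HasLaw (X i) (volume.withDensity fun t => ENNReal.ofReal (f t)) P

/-- The probability `P {|⟨α, X⟩| ≤ |⟨β, X⟩|}`. -/
noncomputable def domProb {Ω : Type*} [MeasurableSpace Ω] (P : Measure Ω) {n : ℕ}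
    (X : Fin n → Ω → ℝ) (α β : EuclideanSpace ℝ (Fin n)) : ℝ :=
  P.real {ω | |∑ i, α i * X i ω| ≤ |∑ i, β i * X i ω|}

universe u

/-- `C` is a constant for the relative anti-concentration inequality for symmetric log-concave
densities: `P {|⟨α, X⟩| ≤ |⟨β, X⟩|} ≤ C ‖β‖ / ‖α‖` for all `n`, all `α ≠ 0` and `β` in `ℝⁿ`, and all
i.i.d. `X i` with a log-concave density that is symmetric about `0`. -/
def IsLogConcaveConstant (C : ℝ) : Prop :=
  ∀ (Ω : Type u) [MeasurableSpace Ω] (P : Measure Ω) [IsProbabilityMeasure P] (n : ℕ)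
    (X : Fin n → Ω → ℝ) (f : ℝ → ℝ), IsIIDWithDensity P X f → Function.Even f → IsLogConcave f →
    ∀ α β : EuclideanSpace ℝ (Fin n), α ≠ 0 → domProb P X α β ≤ C * (‖β‖ / ‖α‖)

/-! Write A = ⟨α, X⟩ and B' = ⟨β, X⟩. The proof has two independent halves.

An admissible constant exists. For τ > 0 the indicator of |A| ≤ |B'| is at most (τ² + B'²) h(A),
where h(x) = 1 / (τ² + x²). For a symmetric unimodal density of variance v and height M = f(0), two
bounds suffice. The first is E h(A) ≤ 20 M / (τ‖α‖): among laws of density at most M the uniform one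
is most peaked, peakedness passes to sums (`IsBump.integral_sum_le`), and for uniform sums the bound
follows from the decay of products of `sinc` (`integral_lorentz_unif_le`). The second is E h(A) B'²
≤ 2 v ‖β‖² E h(A) (`IsBump.integral_mul_sum_sq_le`): weighting by h(A) makes products X_i X_j
correlate against the sign of α_i α_j, and positivity of a quadratic form controls all the
off-diagonal terms by the diagonal. Log-concavity enters only through v ≤ (60 / M)², and τ = 60‖β‖ /
M gives 3600.

Transfer to unimodal densities. A symmetric unimodal law is that of R U, with U uniform on [-1, 1]
and R an independent positive scale (`map_levelMeasure_prod_unif`). Given the scales, the uniform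
case of the hypothesis on C applies with coefficients α_i R_i and β_i R_i, so it remains to average
‖βR‖ / ‖αR‖. The two integral conditions on f amount to E R² ≤ 3B and E R⁻² ≤ 1 + 2B, and
`norm_div_norm_le` bounds the ratio by sums of functions of a single R_i, so that these two moments
are enough. -/

/-! ### Even unimodal test functions and Wintner's theorem -/

/-- A real function that is a nonincreasing function of the absolute value. -/
def RadiallyAntitone (f : ℝ → ℝ) : Prop :=
  ∀ x y : ℝ, |x| ≤ |y| → f y ≤ f x

/-- A nonnegative continuous function that is nonincreasing in the absolute value. -/
structure IsBump (h : ℝ → ℝ) : Prop where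
  continuous : Continuous h
  nonneg : ∀ x, 0 ≤ h x
  anti : RadiallyAntitone h

namespace RadiallyAntitone

variable {f : ℝ → ℝ}

lemma even (hf : RadiallyAntitone f) (x : ℝ) : f (-x) = f x :=
  le_antisymm (hf _ _ (by simp)) (hf _ _ (by simp))

lemma le_zero (hf : RadiallyAntitone f) (x : ℝ) : f x ≤ f 0 := hf _ _ (by simp)

lemma measurable (hf : RadiallyAntitone f) : Measurable f := by
  have h1 : Antitone fun t : ℝ => f (max t 0) := by
    intro s t hst
    apply hf
    rw [abs_of_nonneg (le_max_right _ _), abs_of_nonneg (le_max_right _ _)]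
    exact max_le_max_right 0 hst
  have h2 : f = fun x => (fun t : ℝ => f (max t 0)) |x| := by
    funext x
    exact le_antisymm (hf _ _ (by simp)) (hf _ _ (by simp))
  rw [h2]
  exact h1.measurable.comp measurable_abs

end RadiallyAntitone

namespace IsBump

variable {h : ℝ → ℝ}

lemma even (hh : IsBump h) (x : ℝ) : h (-x) = h x := hh.anti.even x

lemma norm_le (hh : IsBump h) (x : ℝ) : ‖h x‖ ≤ h 0 := by
  rw [Real.norm_of_nonneg (hh.nonneg x)]
  exact hh.anti.le_zero x

lemma integrable_comp (hh : IsBump h) {Ω : Type*} [MeasurableSpace Ω] {P : Measure Ω}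
    [IsFiniteMeasure P] {X : Ω → ℝ} (hX : AEMeasurable X P) : Integrable (fun ω => h (X ω)) P :=
  Integrable.of_bound (hh.continuous.measurable.comp_aemeasurable hX).aestronglyMeasurable (h 0)
    (ae_of_all _ fun _ => hh.norm_le _)

end IsBump

/-- The measure on the real line with density `f`. -/
noncomputable def densityMeasure (f : ℝ → ℝ) : Measure ℝ :=
  volume.withDensity fun t => ENNReal.ofReal (f t)

lemma integral_densityMeasure {f : ℝ → ℝ} (hf : Measurable f) (hf0 : ∀ t, 0 ≤ f t) (F : ℝ → ℝ) :
    ∫ x, F x ∂(densityMeasure f) = ∫ x, F x * f x := by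
  rw [densityMeasure, integral_withDensity_eq_integral_toReal_smul (by fun_prop)
    (ae_of_all _ fun _ => ENNReal.ofReal_lt_top)]
  refine integral_congr_ae (ae_of_all _ fun x => ?_)
  simp [ENNReal.toReal_ofReal (hf0 x), mul_comm]

lemma integrable_densityMeasure_iff {f : ℝ → ℝ} (hf : Measurable f) (hf0 : ∀ t, 0 ≤ f t)
    {F : ℝ → ℝ} : Integrable F (densityMeasure f) ↔ Integrable fun x => F x * f x := by
  rw [densityMeasure, integrable_withDensity_iff (by fun_prop)
    (ae_of_all _ fun _ => ENNReal.ofReal_lt_top)]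
  simp only [ENNReal.toReal_ofReal (hf0 _)]

lemma integrable_density {f : ℝ → ℝ} (hf : Measurable f) (hf0 : ∀ t, 0 ≤ f t)
    [IsProbabilityMeasure (densityMeasure f)] : Integrable f := by
  simpa using (integrable_densityMeasure_iff hf hf0 (F := fun _ => 1)).1 (integrable_const _)

lemma integral_density_eq_one {f : ℝ → ℝ} (hf : Measurable f) (hf0 : ∀ t, 0 ≤ f t)
    [IsProbabilityMeasure (densityMeasure f)] : ∫ x, f x = 1 := by
  simpa using (integral_densityMeasure hf hf0 (fun _ => 1)).symm

lemma integral_densityMeasure_comp_neg {f : ℝ → ℝ} (hf : RadiallyAntitone f) (hf0 : ∀ t, 0 ≤ f t)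
    (F : ℝ → ℝ) : ∫ x, F (-x) ∂(densityMeasure f) = ∫ x, F x ∂(densityMeasure f) := by
  rw [integral_densityMeasure hf.measurable hf0, integral_densityMeasure hf.measurable hf0,
    ← integral_neg_eq_self]
  simp [hf.even]

/-- The reflection x ↦ -(c + d)/a - x exchanges c + a x and d + a x up to sign. Both factors change
sign only where c + d + 2 a x does, and in the same direction. -/
lemma RadiallyAntitone.sub_mul_sub_nonneg {f h : ℝ → ℝ} (hf : RadiallyAntitone f)
    (hh : RadiallyAntitone h) (a : ℝ) (ha : 0 < a) {c d : ℝ} (hc : 0 ≤ c) (hcd : c ≤ d) (x : ℝ) :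
    0 ≤ (h (c + a * x) - h (d + a * x)) * (f x - f (-((c + d) / a) - x)) := by
  have e1 : (d + a * x) ^ 2 - (c + a * x) ^ 2 = (d - c) * (c + d + 2 * (a * x)) := by ring
  have e2 : (-((c + d) / a) - x) ^ 2 - x ^ 2 = (c + d) / a ^ 2 * (c + d + 2 * (a * x)) := by
    field_simp; ring
  have h3 : 0 ≤ (c + d) / a ^ 2 := by have := hc.trans hcd; positivity
  rcases le_total 0 (c + d + 2 * (a * x)) with h0 | h0
  · refine mul_nonneg (sub_nonneg.2 (hh _ _ (sq_le_sq.1 ?_)))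
      (sub_nonneg.2 (hf _ _ (sq_le_sq.1 ?_)))
    · nlinarith [mul_nonneg (sub_nonneg.2 hcd) h0]
    · nlinarith [mul_nonneg h3 h0]
  · refine mul_nonneg_of_nonpos_of_nonpos (sub_nonpos.2 (hh _ _ (sq_le_sq.1 ?_)))
      (sub_nonpos.2 (hf _ _ (sq_le_sq.1 ?_)))
    · nlinarith [mul_nonneg_of_nonpos_of_nonpos (sub_nonpos.2 hcd) h0]
    · nlinarith [mul_nonneg h3 (neg_nonneg.2 h0)]

/-- Averaging the difference of the two sides with its image under that reflection turns the
integrand into the nonnegative product of `RadiallyAntitone.sub_mul_sub_nonneg`. -/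
lemma IsBump.integral_shift_le {f : ℝ → ℝ} (hf : RadiallyAntitone f) (hf0 : ∀ t, 0 ≤ f t)
    [IsProbabilityMeasure (densityMeasure f)] {h : ℝ → ℝ} (hh : IsBump h) {a : ℝ} (ha : 0 < a)
    {c d : ℝ} (hc : 0 ≤ c) (hcd : c ≤ d) :
    ∫ x, h (d + a * x) ∂(densityMeasure f) ≤ ∫ x, h (c + a * x) ∂(densityMeasure f) := by
  have hi : ∀ e : ℝ, Integrable fun x => h (e + a * x) * f x := fun e =>
    (integrable_densityMeasure_iff hf.measurable hf0).1
      (hh.integrable_comp (by fun_prop))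
  rw [integral_densityMeasure hf.measurable hf0, integral_densityMeasure hf.measurable hf0,
    ← sub_nonneg, ← integral_sub (hi c) (hi d)]
  set I := ∫ x, h (c + a * x) * f x - h (d + a * x) * f x with hI
  set m := -((c + d) / a) with hm
  have hr : ∀ x, h (c + a * (m - x)) = h (d + a * x) ∧ h (d + a * (m - x)) = h (c + a * x) := by
    intro x
    constructor
    · rw [← hh.even]; congr 1; rw [hm]; field_simp; ring
    · rw [← hh.even]; congr 1; rw [hm]; field_simp; ring
  have hI2 : I = ∫ x, h (d + a * x) * f (m - x) - h (c + a * x) * f (m - x) := by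
    rw [hI, ← integral_sub_left_eq_self _ volume m]
    simp only [hr]
  have hi1 : Integrable fun x => h (c + a * x) * f x - h (d + a * x) * f x := (hi c).sub (hi d)
  have hi2 : Integrable fun x => h (d + a * x) * f (m - x) - h (c + a * x) * f (m - x) := by
    have := hi1.comp_sub_left m
    simpa only [hr] using this
  have h2 : I + I = ∫ x, (h (c + a * x) - h (d + a * x)) * (f x - f (m - x)) := by
    nth_rewrite 2 [hI2]
    rw [hI, ← integral_add hi1 hi2]
    congr 1 with x
    ring
  have h3 : 0 ≤ I + I := by
    rw [h2]
    exact integral_nonneg fun x => hf.sub_mul_sub_nonneg hh.anti a ha hc hcd x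
  linarith

/-- Wintner's theorem: averaging over a symmetric unimodal law preserves symmetric unimodality. -/
lemma IsBump.average {f : ℝ → ℝ} (hf : RadiallyAntitone f) (hf0 : ∀ t, 0 ≤ f t)
    [IsProbabilityMeasure (densityMeasure f)] {h : ℝ → ℝ} (hh : IsBump h) (a : ℝ) :
    IsBump fun c => ∫ x, h (c + a * x) ∂(densityMeasure f) := by
  wlog ha : 0 ≤ a generalizing a
  · have := this (-a) (by linarith)
    convert this using 2 with c
    rw [← integral_densityMeasure_comp_neg hf hf0]
    simp
  refine ⟨?_, fun c => integral_nonneg fun x => hh.nonneg _, ?_⟩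
  · refine continuous_of_dominated (bound := fun _ => h 0) (fun c => ?_)
      (fun c => ae_of_all _ fun x => hh.norm_le _) (integrable_const _) (ae_of_all _ fun x => ?_)
    · exact (hh.continuous.comp (by fun_prop)).aestronglyMeasurable
    · exact hh.continuous.comp (by fun_prop)
  · rcases ha.eq_or_lt with rfl | ha
    · intro x y hxy
      simpa using hh.anti x y hxy
    · have he : ∀ c, ∫ x, h (|c| + a * x) ∂(densityMeasure f)
          = ∫ x, h (c + a * x) ∂(densityMeasure f) := by
        intro c
        rcases abs_cases c with ⟨h1, _⟩ | ⟨h1, _⟩ <;> rw [h1]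
        rw [← integral_densityMeasure_comp_neg hf hf0]
        congr 1 with x
        rw [← hh.even]
        congr 1
        ring
      intro x y hxy
      simp only
      rw [← he x, ← he y]
      exact hh.integral_shift_le hf hf0 ha (abs_nonneg x) hxy

/-! ### Conditioning on one summand, and peakedness of sums -/

lemma ProbabilityTheory.IndepFun.integral_comp {Ω : Type*} [MeasurableSpace Ω] {P : Measure Ω}
    [IsProbabilityMeasure P] {E E' : Type*} [MeasurableSpace E] [MeasurableSpace E']
    {X : Ω → E} {Z : Ω → E'} (hi : IndepFun X Z P) (hX : AEMeasurable X P) (hZ : AEMeasurable Z P)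
    {F : E → E' → ℝ} (hF : Measurable (Function.uncurry F))
    (hFi : Integrable (fun ω => F (X ω) (Z ω)) P) :
    ∫ ω, F (X ω) (Z ω) ∂P = ∫ ω, ∫ ω', F (X ω) (Z ω') ∂P ∂P := by
  have := Measure.isProbabilityMeasure_map hX (μ := P)
  have := Measure.isProbabilityMeasure_map hZ (μ := P)
  have hmap := (indepFun_iff_map_prod_eq_prod_map_map hX hZ).1 hi
  have hFi' : Integrable (Function.uncurry F) ((P.map X).prod (P.map Z)) := by
    rw [← hmap]
    exact (integrable_map_measure hF.aestronglyMeasurable (hX.prodMk hZ)).2 hFi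
  calc ∫ ω, F (X ω) (Z ω) ∂P
      = ∫ p, Function.uncurry F p ∂(P.map fun ω => (X ω, Z ω)) :=
        (integral_map (hX.prodMk hZ) hF.aestronglyMeasurable).symm
    _ = ∫ x, ∫ z, F x z ∂(P.map Z) ∂(P.map X) := by
        rw [hmap, integral_prod _ hFi']; rfl
    _ = ∫ ω, ∫ z, F (X ω) z ∂(P.map Z) ∂P :=
        integral_map hX hFi'.integral_prod_left.aestronglyMeasurable
    _ = _ := by
        congr 1 with ω
        exact integral_map hZ (hF.comp measurable_prodMk_left).aestronglyMeasurable

section LinearForms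

variable {Ω : Type*} [MeasurableSpace Ω] {P : Measure Ω} {ι : Type*}
  {X : ι → Ω → ℝ}

lemma aemeasurable_sum_mul (hX : ∀ i, AEMeasurable (X i) P) (a : ι → ℝ) (S : Finset ι) :
    AEMeasurable (fun ω => ∑ k ∈ S, a k * X k ω) P :=
  Finset.aemeasurable_fun_sum S fun k _ => (hX k).const_mul (a k)

lemma ProbabilityTheory.iIndepFun.indepFun_sum_mul (hi : iIndepFun X P)
    (hX : ∀ i, AEMeasurable (X i) P) (a : ι → ℝ) {S : Finset ι} {i : ι} (hiS : i ∉ S) :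
    IndepFun (X i) (fun ω => ∑ k ∈ S, a k * X k ω) P := by
  have h := hi.indepFun_finset₀ {i} S (by simpa using hiS) hX
  have hφ : Measurable fun v : ({i} : Finset ι) → ℝ => v ⟨i, by simp⟩ := measurable_pi_apply _
  have hψ : Measurable fun v : S → ℝ => ∑ k : S, a k * v k := by fun_prop
  have h2 := h.comp hφ hψ
  refine h2.congr (ae_of_all _ fun ω => rfl) (ae_of_all _ fun ω => ?_)
  exact Finset.sum_coe_sort S fun k => a k * X k ω

variable [DecidableEq ι]

lemma ProbabilityTheory.iIndepFun.indepFun_prodMk_sum_mul (hi : iIndepFun X P)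
    (hX : ∀ i, AEMeasurable (X i) P) (a : ι → ℝ) {S : Finset ι} {i j : ι} (hij : i ≠ j)
    (hiS : i ∉ S) : IndepFun (X i) (fun ω => (X j ω, ∑ k ∈ S, a k * X k ω)) P := by
  have h := hi.indepFun_finset₀ {i} (insert j S) (by simp [hij, hiS]) hX
  have hφ : Measurable fun v : ({i} : Finset ι) → ℝ => v ⟨i, by simp⟩ := measurable_pi_apply _
  have hψ : Measurable fun v : ((insert j S : Finset ι) : Type _) → ℝ =>
      (v ⟨j, by simp⟩, ∑ k : S, a k * v ⟨k, by simp⟩) :=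
    (measurable_pi_apply _).prodMk
      (Finset.measurable_fun_sum _ fun k _ => (measurable_pi_apply _).const_mul _)
  have h2 := h.comp hφ hψ
  refine h2.congr (ae_of_all _ fun ω => rfl) (ae_of_all _ fun ω => ?_)
  exact congrArg (Prod.mk (X j ω)) (Finset.sum_coe_sort S fun k => a k * X k ω)

variable [IsProbabilityMeasure P] {f : ℝ → ℝ}

/-- Stated for bounded continuous functions because it serves both bumps and the cosine. -/
lemma integral_sum_insert (hX : ∀ i, HasLaw (X i) (densityMeasure f) P)
    (hi : iIndepFun X P) {h : ℝ → ℝ} (hc : Continuous h) {K : ℝ} (hK : ∀ x, ‖h x‖ ≤ K)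
    (a : ι → ℝ) {S : Finset ι} {i : ι} (hiS : i ∉ S) (c : ℝ) :
    ∫ ω, h (c + ∑ k ∈ insert i S, a k * X k ω) ∂P
      = ∫ ω, ∫ x, h (c + ∑ k ∈ S, a k * X k ω + a i * x) ∂(densityMeasure f) ∂P := by
  have hZ := aemeasurable_sum_mul (fun i => (hX i).aemeasurable) a S
  have hXi := (hX i).aemeasurable
  have hind := (hi.indepFun_sum_mul (fun i => (hX i).aemeasurable) a hiS).symm
  have hm : Measurable (Function.uncurry fun z x : ℝ => h (c + z + a i * x)) :=
    (hc.comp (by fun_prop)).measurable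
  have key := hind.integral_comp hZ hXi hm (Integrable.of_bound
    (hc.measurable.comp_aemeasurable (by fun_prop)).aestronglyMeasurable K
    (ae_of_all _ fun _ => hK _))
  simp_rw [Finset.sum_insert hiS]
  refine Eq.trans (integral_congr_ae (ae_of_all _ fun ω => ?_)) (key.trans ?_)
  · simp only; congr 1; ring
  · congr 1 with ω
    exact (hX i).integral_comp (f := fun x => h (c + ∑ k ∈ S, a k * X k ω + a i * x))
      (hc.comp (by fun_prop)).aestronglyMeasurable

lemma IsBump.integral_insert (hX : ∀ i, HasLaw (X i) (densityMeasure f) P)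
    (hi : iIndepFun X P) {h : ℝ → ℝ} (hh : IsBump h) (a : ι → ℝ) {S : Finset ι} {i : ι}
    (hiS : i ∉ S) (c : ℝ) :
    ∫ ω, h (c + ∑ k ∈ insert i S, a k * X k ω) ∂P
      = ∫ ω, ∫ x, h (c + ∑ k ∈ S, a k * X k ω + a i * x) ∂(densityMeasure f) ∂P :=
  integral_sum_insert hX hi hh.continuous hh.norm_le a hiS c

variable [IsProbabilityMeasure (densityMeasure f)]

lemma IsBump.integral_sum (hf : RadiallyAntitone f) (hf0 : ∀ t, 0 ≤ f t)
    (hX : ∀ i, HasLaw (X i) (densityMeasure f) P) (hi : iIndepFun X P) {h : ℝ → ℝ}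
    (hh : IsBump h) (a : ι → ℝ) (S : Finset ι) :
    IsBump fun c => ∫ ω, h (c + ∑ k ∈ S, a k * X k ω) ∂P := by
  induction S using Finset.induction_on generalizing h with
  | empty => simpa using hh
  | insert i S hiS ih =>
    simp_rw [hh.integral_insert hX hi a hiS]
    exact ih (hh.average hf hf0 (a i))

/-- Sums of independent symmetric unimodal variables are peaked in the order of the summands. -/
lemma IsBump.integral_sum_le {Ω' : Type*} [MeasurableSpace Ω'] {P' : Measure Ω'}
    [IsProbabilityMeasure P'] {X' : ι → Ω' → ℝ} {f' : ℝ → ℝ}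
    [IsProbabilityMeasure (densityMeasure f')]
    (hf : RadiallyAntitone f) (hf0 : ∀ t, 0 ≤ f t)
    (hf' : RadiallyAntitone f') (hf0' : ∀ t, 0 ≤ f' t)
    (hX : ∀ i, HasLaw (X i) (densityMeasure f) P) (hi : iIndepFun X P)
    (hX' : ∀ i, HasLaw (X' i) (densityMeasure f') P') (hi' : iIndepFun X' P') (a a' : ι → ℝ)
    (hle : ∀ h, IsBump h → ∀ i, ∫ x, h (a i * x) ∂(densityMeasure f)
      ≤ ∫ x, h (a' i * x) ∂(densityMeasure f')) {h : ℝ → ℝ} (hh : IsBump h) (S : Finset ι) :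
    ∫ ω, h (∑ k ∈ S, a k * X k ω) ∂P ≤ ∫ ω, h (∑ k ∈ S, a' k * X' k ω) ∂P' := by
  induction S using Finset.induction_on generalizing h with
  | empty => simp
  | insert i S hiS ih =>
    have h1 := hh.integral_insert hX hi a hiS 0
    have h2 := hh.integral_insert hX' hi' a' hiS 0
    simp only [zero_add] at h1 h2
    rw [h1, h2]
    have hg := hh.integral_sum hf' hf0' hX' hi' a' S
    have hZ := aemeasurable_sum_mul (fun i => (hX' i).aemeasurable) a' S
    have hswap : ∀ (ρ : Measure ℝ) [IsProbabilityMeasure ρ] (b : ℝ),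
        ∫ ω, ∫ x, h (∑ k ∈ S, a' k * X' k ω + b * x) ∂ρ ∂P'
          = ∫ x, ∫ ω, h (b * x + ∑ k ∈ S, a' k * X' k ω) ∂P' ∂ρ := by
      intro ρ _ b
      rw [integral_integral_swap]
      · simp_rw [add_comm]
      · exact hh.integrable_comp (X := fun p : Ω' × ℝ => ∑ k ∈ S, a' k * X' k p.1 + b * p.2)
          (hZ.comp_fst.add (by fun_prop))
    -- The summands are exchanged one at a time: the old `X i` is averaged into the test function
    -- while the others are replaced. After swapping integrals, the new sum over `S` is averaged
    -- instead, and `hle` exchanges `X i`.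
    refine (ih (hh.average hf hf0 (a i))).trans ?_
    rw [hswap, hswap]
    exact hle _ hg i

end LinearForms

/-! ### The uniform law as the most peaked bounded density -/

/-- The density of the uniform distribution on `[-1, 1]`. -/
noncomputable def unifDensity (t : ℝ) : ℝ := if |t| ≤ 1 then 1 / 2 else 0

lemma unifDensity_nonneg (t : ℝ) : 0 ≤ unifDensity t := by
  unfold unifDensity; split_ifs <;> norm_num

lemma radiallyAntitone_unifDensity : RadiallyAntitone unifDensity := by
  intro x y hxy
  unfold unifDensity
  split_ifs with h1 h2 <;> first | exact absurd (hxy.trans h1) h2 | norm_num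

lemma unifDensity_eq_indicator : unifDensity = (Icc (-1 : ℝ) 1).indicator fun _ => 1 / 2 := by
  funext t
  simp only [unifDensity, indicator, mem_Icc, abs_le]

instance : IsProbabilityMeasure (densityMeasure unifDensity) := by
  constructor
  rw [densityMeasure, withDensity_apply _ MeasurableSet.univ, Measure.restrict_univ]
  have : ∀ t, ENNReal.ofReal (unifDensity t)
      = (Icc (-1 : ℝ) 1).indicator (fun _ => ENNReal.ofReal (1 / 2)) t := by
    intro t
    rw [unifDensity_eq_indicator]
    simp only [indicator]
    split_ifs <;> simp
  simp_rw [this]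
  rw [lintegral_indicator measurableSet_Icc, setLIntegral_const, Real.volume_Icc,
    ← ENNReal.ofReal_mul (by norm_num)]
  norm_num

lemma integral_unif (F : ℝ → ℝ) :
    ∫ x, F x ∂(densityMeasure unifDensity) = (1 / 2) * ∫ x in (-1)..1, F x := by
  rw [integral_densityMeasure radiallyAntitone_unifDensity.measurable unifDensity_nonneg,
    intervalIntegral.integral_of_le (by norm_num), ← integral_Icc_eq_integral_Ioc,
    ← integral_indicator measurableSet_Icc, ← integral_const_mul, unifDensity_eq_indicator]
  congr 1 with x
  by_cases hx : x ∈ Icc (-1 : ℝ) 1 <;> simp [hx, mul_comm]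

/-- Among densities bounded by `M`, the uniform one is the most peaked. -/
lemma IsBump.integral_le_unif {f : ℝ → ℝ} (hf : RadiallyAntitone f) (hf0 : ∀ t, 0 ≤ f t)
    [IsProbabilityMeasure (densityMeasure f)] {M : ℝ} (hM : 0 < M) (hfM : ∀ t, f t ≤ M)
    {h : ℝ → ℝ} (hh : IsBump h) (a : ℝ) :
    ∫ x, h (a * x) ∂(densityMeasure f)
      ≤ ∫ x, h (a / (2 * M) * x) ∂(densityMeasure unifDensity) := by
  set r := 1 / (2 * M) with hr
  have hr0 : 0 < r := by positivity
  have h1 : ∫ x, h (a / (2 * M) * x) ∂(densityMeasure unifDensity)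
      = ∫ x in (-r)..r, M * h (a * x) := by
    have := intervalIntegral.integral_comp_mul_left (f := fun x => h (a * x)) (a := -1) (b := 1)
      (c := r) hr0.ne'
    rw [integral_unif, intervalIntegral.integral_const_mul]
    have e : ∀ x, h (a / (2 * M) * x) = h (a * (r * x)) := by
      intro x; congr 1; rw [hr]; ring
    simp_rw [e]
    rw [this, hr]
    simp only [smul_eq_mul]
    field_simp
  have hcont : Continuous fun x => h (a * x) := hh.continuous.comp (by fun_prop)
  have hint : Integrable ((Icc (-r) r).indicator fun _ : ℝ => M) :=
    (integrable_indicator_iff measurableSet_Icc).2 (by simp)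
  have hint1 : Integrable ((Icc (-r) r).indicator fun x : ℝ => M * h (a * x)) :=
    (integrable_indicator_iff measurableSet_Icc).2
      ((hcont.const_mul M |>.continuousOn).integrableOn_compact isCompact_Icc)
  have hint2 : Integrable fun x => h (a * x) * f x :=
    (integrable_densityMeasure_iff hf.measurable hf0).1 (hh.integrable_comp (by fun_prop))
  have hint3 := integrable_density hf.measurable hf0
  have hI : ∫ x, (Icc (-r) r).indicator (fun _ : ℝ => M) x = 1 := by
    rw [integral_indicator measurableSet_Icc]
    simp only [integral_const, smul_eq_mul, MeasurableSet.univ, measureReal_restrict_apply,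
      univ_inter, Real.volume_real_Icc]
    rw [max_eq_left (by linarith), hr]
    field_simp
    norm_num
  rw [h1, intervalIntegral.integral_of_le (by linarith), ← integral_Icc_eq_integral_Ioc,
    ← integral_indicator measurableSet_Icc, integral_densityMeasure hf.measurable hf0,
    ← sub_nonneg, ← integral_sub hint1 hint2]
  -- The two densities have equal mass and cross at |x| = r. Subtracting the constant h(a r) costs
  -- nothing and makes (h(a x) - h(a r)) (M 1_{|x| ≤ r} - f x) nonnegative pointwise.
  have hz : ∫ x, h (a * r) * ((Icc (-r) r).indicator (fun _ : ℝ => M) x - f x) = 0 := by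
    rw [integral_const_mul, integral_sub hint hint3, hI,
      integral_density_eq_one hf.measurable hf0]
    simp
  rw [← hz]
  refine integral_mono ((hint.sub hint3).const_mul _) (hint1.sub hint2) fun x => ?_
  by_cases hx : x ∈ Icc (-r) r
  · have : h (a * r) ≤ h (a * x) := hh.anti _ _ (by
      rw [abs_mul, abs_mul, abs_of_pos hr0]
      exact mul_le_mul_of_nonneg_left (abs_le.2 hx) (abs_nonneg a))
    simp only [indicator_of_mem hx]
    nlinarith [hfM x]
  · have : h (a * x) ≤ h (a * r) := hh.anti _ _ (by
      rw [abs_mul, abs_mul, abs_of_pos hr0]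
      exact mul_le_mul_of_nonneg_left (not_le.1 fun h => hx (abs_le.1 h)).le (abs_nonneg a))
    simp only [indicator_of_notMem hx]
    nlinarith [hf0 x]

/-! ### The second moment of one linear form weighted by a bump of another -/

section QuadraticForm

variable {f : ℝ → ℝ}

/-- Chebyshev's association inequality for `x ^ 2` and a bump. -/
lemma IsBump.integral_sq_mul_le [IsProbabilityMeasure (densityMeasure f)]
    (h2 : Integrable (fun x => x ^ 2) (densityMeasure f)) {g : ℝ → ℝ} (hg : IsBump g) (a : ℝ) :
    ∫ x, g (a * x) * x ^ 2 ∂(densityMeasure f)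
      ≤ (∫ x, x ^ 2 ∂(densityMeasure f)) * ∫ x, g (a * x) ∂(densityMeasure f) := by
  set v := ∫ x, x ^ 2 ∂(densityMeasure f) with hv
  have hv0 : 0 ≤ v := integral_nonneg fun x => sq_nonneg x
  have hgi : Integrable (fun x => g (a * x)) (densityMeasure f) := hg.integrable_comp (by fun_prop)
  have hg2 : Integrable (fun x => g (a * x) * x ^ 2) (densityMeasure f) :=
    h2.bdd_mul (c := g 0) hgi.aestronglyMeasurable (ae_of_all _ fun x => hg.norm_le _)
  -- The same crossing device: x² - v has mean zero and changes sign at |x| = √v.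
  have hz : ∫ x, g (a * √v) * (x ^ 2 - v) ∂(densityMeasure f) = 0 := by
    rw [integral_const_mul, integral_sub h2 (integrable_const _), ← hv]
    simp
  rw [← sub_nonneg, ← integral_const_mul, ← integral_sub (hgi.const_mul v) hg2,
    ← neg_zero, ← hz, ← integral_neg]
  refine integral_mono (((h2.sub (integrable_const v)).const_mul _).neg)
    ((hgi.const_mul v).sub hg2) fun x => ?_
  simp only
  have hs := Real.sq_sqrt hv0
  rcases le_total (x ^ 2) v with hx | hx
  · have : g (a * √v) ≤ g (a * x) := hg.anti _ _ (by
      rw [← sq_le_sq, mul_pow, mul_pow, hs]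
      exact mul_le_mul_of_nonneg_left hx (sq_nonneg a))
    nlinarith
  · have : g (a * x) ≤ g (a * √v) := hg.anti _ _ (by
      rw [← sq_le_sq, mul_pow, mul_pow, hs]
      exact mul_le_mul_of_nonneg_left hx (sq_nonneg a))
    nlinarith

/-- Here `s` is a sign of a b. Pairing x with -x, the point with s x y ≥ 0 has the larger |a x + b
y|, hence the smaller weight. -/
lemma IsBump.integral_mul_mul_nonpos (hf : RadiallyAntitone f) (hf0 : ∀ t, 0 ≤ f t)
    (h2 : Integrable (fun x => x) (densityMeasure f)) {g : ℝ → ℝ} (hg : IsBump g) (a b s : ℝ)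
    (hs : s ^ 2 = 1) (hab : 0 ≤ s * (a * b)) :
    s * ∫ x, ∫ y, g (a * x + b * y) * (x * y) ∂(densityMeasure f) ∂(densityMeasure f) ≤ 0 := by
  set φ : ℝ → ℝ := fun x => ∫ y, g (a * x + b * y) * (x * y) ∂(densityMeasure f) with hφ
  -- A nonintegrable function has integral 0 by convention, so that case is trivial.
  by_cases hi : Integrable φ (densityMeasure f)
  swap
  · rw [integral_undef hi]; simp
  have hneg := integral_densityMeasure_comp_neg hf hf0 φ
  have hi' : Integrable (fun x => φ (-x)) (densityMeasure f) := by
    rw [integrable_densityMeasure_iff hf.measurable hf0] at hi ⊢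
    simpa [hf.even] using hi.comp_neg
  have hin : ∀ u x : ℝ, Integrable (fun y => g (u + b * y) * (x * y)) (densityMeasure f) :=
    fun u x => (h2.const_mul x).bdd_mul (c := g 0)
      (hg.continuous.comp (by fun_prop)).aestronglyMeasurable (ae_of_all _ fun y => hg.norm_le _)
  have hsum : s * ∫ x, φ x + φ (-x) ∂(densityMeasure f) ≤ 0 := by
    rw [← integral_const_mul]
    refine integral_nonpos fun x => ?_
    simp only [hφ]
    rw [← integral_add (hin _ _) (hin _ _), ← integral_const_mul]
    refine integral_nonpos fun y => ?_
    have e : (a * x + b * y) ^ 2 - (a * -x + b * y) ^ 2 = 4 * ((s * (a * b)) * (s * (x * y))) := by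
      linear_combination (-4 * (a * b * x * y)) * hs
    have e2 : s * (g (a * x + b * y) * (x * y) + g (a * -x + b * y) * (-x * y))
      = (s * (x * y)) * (g (a * x + b * y) - g (a * -x + b * y)) := by ring
    simp only [Pi.zero_apply]
    rw [e2]
    rcases le_total 0 (s * (x * y)) with h0 | h0
    · refine mul_nonpos_of_nonneg_of_nonpos h0 (sub_nonpos.2 (hg.anti _ _ (sq_le_sq.1 ?_)))
      linarith [mul_nonneg hab h0]
    · refine mul_nonpos_of_nonpos_of_nonneg h0 (sub_nonneg.2 (hg.anti _ _ (sq_le_sq.1 ?_)))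
      linarith [mul_nonpos_of_nonneg_of_nonpos hab h0]
  rw [integral_add hi hi', hneg] at hsum
  linarith

variable {Ω : Type*} [MeasurableSpace Ω] {P : Measure Ω}

lemma integrable_comp_of_hasLaw {ν : Measure ℝ} {Y : Ω → ℝ} (hY : HasLaw Y ν P) {F : ℝ → ℝ}
    (hF : Integrable F ν) : Integrable (fun ω => F (Y ω)) P := by
  rw [← hY.map_eq] at hF
  exact hF.comp_aemeasurable hY.aemeasurable

variable [IsProbabilityMeasure P] [IsProbabilityMeasure (densityMeasure f)]
  {ι : Type*} [DecidableEq ι] [Fintype ι] {X : ι → Ω → ℝ}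

/-- Averaging over the other summands turns h into another bump, which leaves the one-variable
inequality `IsBump.integral_sq_mul_le`. -/
lemma IsBump.integral_mul_sq_le (hf : RadiallyAntitone f) (hf0 : ∀ t, 0 ≤ f t)
    (h2 : Integrable (fun x => x ^ 2) (densityMeasure f))
    (hX : ∀ i, HasLaw (X i) (densityMeasure f) P) (hi : iIndepFun X P) {h : ℝ → ℝ}
    (hh : IsBump h) (a : ι → ℝ) (i : ι) :
    ∫ ω, h (∑ k, a k * X k ω) * X i ω ^ 2 ∂P
      ≤ (∫ x, x ^ 2 ∂(densityMeasure f)) * ∫ ω, h (∑ k, a k * X k ω) ∂P := by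
  have hXm := fun i => (hX i).aemeasurable
  have hiS : i ∉ Finset.univ.erase i := by simp
  have hZ := aemeasurable_sum_mul hXm a (Finset.univ.erase i)
  have hind := hi.indepFun_sum_mul hXm a hiS
  have hg := hh.integral_sum hf hf0 hX hi a (Finset.univ.erase i)
  set Z := fun ω => ∑ k ∈ Finset.univ.erase i, a k * X k ω with hZdef
  have hA : ∀ ω, ∑ k, a k * X k ω = a i * X i ω + Z ω := fun ω =>
    (Finset.add_sum_erase _ _ (Finset.mem_univ i)).symm
  have hXi := hXm i
  have hint : Integrable (fun ω => h (a i * X i ω + Z ω)) P := hh.integrable_comp (by fun_prop)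
  have hint2 : Integrable (fun ω => h (a i * X i ω + Z ω) * X i ω ^ 2) P :=
    (integrable_comp_of_hasLaw (hX i) h2).bdd_mul (c := h 0) hint.aestronglyMeasurable
      (ae_of_all _ fun x => hh.norm_le _)
  have hm := hh.continuous.measurable
  simp_rw [hA]
  rw [hind.integral_comp (F := fun x z => h (a i * x + z) * x ^ 2) hXi hZ (by fun_prop) hint2,
    hind.integral_comp (F := fun x z => h (a i * x + z)) hXi hZ (by fun_prop) hint]
  simp_rw [integral_mul_const]
  have hgm : Continuous fun x => ∫ ω, h (a i * x + Z ω) ∂P := hg.continuous.comp (by fun_prop)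
  have e1 := (hX i).integral_comp (f := fun x => (∫ ω, h (a i * x + Z ω) ∂P) * x ^ 2)
    (by fun_prop)
  have e2 := (hX i).integral_comp (f := fun x => ∫ ω, h (a i * x + Z ω) ∂P)
    hgm.aestronglyMeasurable
  simp only [Function.comp_def] at e1 e2
  rw [e1, e2]
  exact hg.integral_sq_mul_le h2 (a i)

/-- As for the squares, averaging over all summands but two reduces to
`IsBump.integral_mul_mul_nonpos`. -/
lemma IsBump.integral_mul_mul_le (hf : RadiallyAntitone f) (hf0 : ∀ t, 0 ≤ f t)
    (h2 : Integrable (fun x => x ^ 2) (densityMeasure f))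
    (hX : ∀ i, HasLaw (X i) (densityMeasure f) P) (hi : iIndepFun X P) {h : ℝ → ℝ}
    (hh : IsBump h) (a : ι → ℝ) {i j : ι} (hij : i ≠ j) (s : ℝ) (hs : s ^ 2 = 1)
    (hab : 0 ≤ s * (a i * a j)) :
    s * ∫ ω, h (∑ k, a k * X k ω) * (X i ω * X j ω) ∂P ≤ 0 := by
  have hXm := fun i => (hX i).aemeasurable
  have hXi := hXm i
  have hXj := hXm j
  set S := (Finset.univ.erase i).erase j with hS
  have hiS : i ∉ S := by simp [hS]
  have hjS : j ∉ S := by simp [hS]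
  have hZ := aemeasurable_sum_mul hXm a S
  have hind2 := hi.indepFun_sum_mul hXm a hjS
  have hg := hh.integral_sum hf hf0 hX hi a S
  set Z := fun ω => ∑ k ∈ S, a k * X k ω with hZdef
  have hind1 : IndepFun (X i) (fun ω => (X j ω, Z ω)) P :=
    hi.indepFun_prodMk_sum_mul hXm a hij hiS
  have hA : ∀ ω, ∑ k, a k * X k ω = a i * X i ω + a j * X j ω + Z ω := fun ω => by
    rw [← Finset.add_sum_erase _ _ (Finset.mem_univ i),
      ← Finset.add_sum_erase (Finset.univ.erase i) _ (a := j) (by simp [hij.symm]), add_assoc]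
  have hm := hh.continuous.measurable
  have h1 : Integrable (fun x => x) (densityMeasure f) := by
    refine Integrable.mono' (h2.add (integrable_const 1)) (by fun_prop) (ae_of_all _ fun x => ?_)
    simp only [Pi.add_apply, Real.norm_eq_abs]
    rw [← sq_abs x]
    nlinarith [sq_nonneg (|x| - 1), abs_nonneg x]
  have hXi2 := integrable_comp_of_hasLaw (hX i) h2
  have hXj2 := integrable_comp_of_hasLaw (hX j) h2
  have hXij : Integrable (fun ω => X i ω * X j ω) P := by
    refine Integrable.mono' (hXi2.add hXj2) (hXi.mul hXj).aestronglyMeasurable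
      (ae_of_all _ fun ω => ?_)
    simp only [Pi.add_apply, Real.norm_eq_abs]
    rw [abs_le]
    constructor <;> nlinarith [sq_nonneg (X i ω + X j ω), sq_nonneg (X i ω - X j ω)]
  have hint : Integrable (fun ω => h (a i * X i ω + a j * X j ω + Z ω) * (X i ω * X j ω)) P :=
    hXij.bdd_mul (c := h 0) (hm.comp_aemeasurable (by fun_prop)).aestronglyMeasurable
      (ae_of_all _ fun x => hh.norm_le _)
  simp_rw [hA]
  rw [hind1.integral_comp (F := fun x p => h (a i * x + a j * p.1 + p.2) * (x * p.1)) hXi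
    (hXj.prodMk hZ) (by fun_prop) hint]
  have hin : ∀ x : ℝ, ∫ ω, h (a i * x + a j * X j ω + Z ω) * (x * X j ω) ∂P
      = ∫ y, (∫ ω, h (a i * x + a j * y + Z ω) ∂P) * (x * y) ∂(densityMeasure f) := by
    intro x
    have hint' : Integrable (fun ω => h (a i * x + a j * X j ω + Z ω) * (x * X j ω)) P :=
      ((integrable_comp_of_hasLaw (hX j) h1).const_mul x).bdd_mul (c := h 0)
        (hm.comp_aemeasurable (by fun_prop)).aestronglyMeasurable
        (ae_of_all _ fun x => hh.norm_le _)
    rw [hind2.integral_comp (F := fun y z => h (a i * x + a j * y + z) * (x * y)) hXj hZ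
      (by fun_prop) hint']
    simp_rw [integral_mul_const]
    have hgm : Continuous fun y => ∫ ω, h (a i * x + a j * y + Z ω) ∂P :=
      hg.continuous.comp (by fun_prop)
    exact (hX j).integral_comp (f := fun y => (∫ ω, h (a i * x + a j * y + Z ω) ∂P) * (x * y))
      (by fun_prop)
  simp only [hin]
  have hgm : Continuous fun p : ℝ × ℝ => ∫ ω, h (a i * p.1 + a j * p.2 + Z ω) ∂P :=
    hg.continuous.comp (by fun_prop)
  have hms : StronglyMeasurable fun x =>
      ∫ y, (∫ ω, h (a i * x + a j * y + Z ω) ∂P) * (x * y) ∂(densityMeasure f) := by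
    refine StronglyMeasurable.integral_prod_right (f := fun x y : ℝ =>
      (∫ ω, h (a i * x + a j * y + Z ω) ∂P) * (x * y)) ?_
    exact (hgm.mul (by fun_prop)).stronglyMeasurable
  have e := (hX i).integral_comp (f := fun x =>
      ∫ y, (∫ ω, h (a i * x + a j * y + Z ω) ∂P) * (x * y) ∂(densityMeasure f))
      hms.aestronglyMeasurable
  simp only [Function.comp_def] at e
  rw [e]
  exact hg.integral_mul_mul_nonpos hf hf0 h1 (a i) (a j) s hs hab

/-- The matrix m_ij = E h(A) X_i X_j is positive semidefinite, and s_i s_j m_ij ≤ 0 off the diagonal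
for signs s_i of a_i. Evaluating the form at (s_i |b_i|) makes every off-diagonal term as negative
as possible, yet the total is nonnegative. So the diagonal dominates the off-diagonal part at b,
which costs the factor 2. -/
lemma IsBump.integral_mul_sum_sq_le (hf : RadiallyAntitone f) (hf0 : ∀ t, 0 ≤ f t)
    (h2 : Integrable (fun x => x ^ 2) (densityMeasure f))
    (hX : ∀ i, HasLaw (X i) (densityMeasure f) P) (hi : iIndepFun X P) {h : ℝ → ℝ}
    (hh : IsBump h) (a b : ι → ℝ) :
    ∫ ω, h (∑ k, a k * X k ω) * (∑ k, b k * X k ω) ^ 2 ∂P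
      ≤ 2 * (∫ x, x ^ 2 ∂(densityMeasure f)) * (∑ k, b k ^ 2)
        * ∫ ω, h (∑ k, a k * X k ω) ∂P := by
  set v := ∫ x, x ^ 2 ∂(densityMeasure f) with hv
  set E := ∫ ω, h (∑ k, a k * X k ω) ∂P with hE
  set m : ι → ι → ℝ := fun i j => ∫ ω, h (∑ k, a k * X k ω) * (X i ω * X j ω) ∂P with hmdef
  have hXm := fun i => (hX i).aemeasurable
  have hA := aemeasurable_sum_mul hXm a Finset.univ
  have hint : ∀ i j, Integrable (fun ω => h (∑ k, a k * X k ω) * (X i ω * X j ω)) P := by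
    intro i j
    have hXij : Integrable (fun ω => X i ω * X j ω) P := by
      refine Integrable.mono' ((integrable_comp_of_hasLaw (hX i) h2).add
        (integrable_comp_of_hasLaw (hX j) h2)) ((hXm i).mul (hXm j)).aestronglyMeasurable
        (ae_of_all _ fun ω => ?_)
      simp only [Pi.add_apply, Real.norm_eq_abs]
      rw [abs_le]
      constructor <;> nlinarith [sq_nonneg (X i ω + X j ω), sq_nonneg (X i ω - X j ω)]
    exact hXij.bdd_mul (c := h 0) (hh.integrable_comp hA).aestronglyMeasurable
      (ae_of_all _ fun x => hh.norm_le _)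
  have hquad : ∀ c : ι → ℝ, ∫ ω, h (∑ k, a k * X k ω) * (∑ k, c k * X k ω) ^ 2 ∂P
      = ∑ i, ∑ j, c i * c j * m i j := by
    intro c
    have : ∀ ω, h (∑ k, a k * X k ω) * (∑ k, c k * X k ω) ^ 2
        = ∑ i, ∑ j, c i * c j * (h (∑ k, a k * X k ω) * (X i ω * X j ω)) := by
      intro ω
      rw [sq, Finset.sum_mul_sum, Finset.mul_sum]
      refine Finset.sum_congr rfl fun i _ => ?_
      rw [Finset.mul_sum]
      exact Finset.sum_congr rfl fun j _ => by ring
    simp_rw [this]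
    rw [integral_finsetSum _ fun i _ => integrable_finsetSum _ fun j _ => (hint i j).const_mul _]
    refine Finset.sum_congr rfl fun i _ => ?_
    rw [integral_finsetSum _ fun j _ => (hint i j).const_mul _]
    exact Finset.sum_congr rfl fun j _ => integral_const_mul _ _
  set s : ι → ℝ := fun i => if 0 ≤ a i then 1 else -1 with hs
  have hs2 : ∀ i, s i ^ 2 = 1 := fun i => by simp only [hs]; split_ifs <;> norm_num
  have hsa : ∀ i, 0 ≤ s i * a i := fun i => by
    simp only [hs]; split_ifs with h <;> linarith
  have hpos : 0 ≤ ∑ i, ∑ j, (s i * |b i|) * (s j * |b j|) * m i j := by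
    rw [← hquad]
    exact integral_nonneg fun ω => mul_nonneg (hh.nonneg _) (sq_nonneg _)
  have hterm : ∀ i j, b i * b j * m i j + (s i * |b i|) * (s j * |b j|) * m i j
      ≤ if i = j then 2 * v * b i ^ 2 * E else 0 := by
    intro i j
    split_ifs with hij
    · subst hij
      have hd := hh.integral_mul_sq_le hf hf0 h2 hX hi a i
      simp only [sq (X i _)] at hd
      have : b i * b i * m i i + (s i * |b i|) * (s i * |b i|) * m i i
          = 2 * b i ^ 2 * m i i := by
        linear_combination (|b i| ^ 2 * m i i) * hs2 i + m i i * sq_abs (b i)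
      rw [this]
      have hb := sq_nonneg (b i)
      change m i i ≤ v * E at hd
      nlinarith
    · have ht := hh.integral_mul_mul_le hf hf0 h2 hX hi a hij (s i * s j)
        (by rw [mul_pow, hs2, hs2, one_mul])
        (by have := mul_nonneg (hsa i) (hsa j); linarith)
      change s i * s j * m i j ≤ 0 at ht
      have e : b i * b j * m i j = (s i * b i) * (s j * b j) * (s i * s j * m i j) := by
        linear_combination (-b i * b j * m i j * s j ^ 2) * hs2 i + (-b i * b j * m i j) * hs2 j
      have hbb : -(|b i| * |b j|) ≤ (s i * b i) * (s j * b j) := by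
        have : |(s i * b i) * (s j * b j)| = |b i| * |b j| := by
          have h1 : ∀ i, |s i| = 1 := fun i => by simp only [hs]; split_ifs <;> simp
          rw [abs_mul, abs_mul, abs_mul, h1, h1]; ring
        rw [← this]
        exact neg_abs_le _
      rw [e]
      nlinarith
  have hsum := Finset.sum_le_sum fun i (_ : i ∈ Finset.univ) =>
    Finset.sum_le_sum fun j (_ : j ∈ Finset.univ) => hterm i j
  simp only [Finset.sum_add_distrib, Finset.sum_ite_eq, Finset.mem_univ, if_true] at hsum
  rw [hquad]
  have e : ∑ i, 2 * v * b i ^ 2 * E = 2 * v * (∑ k, b k ^ 2) * E := by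
    rw [Finset.mul_sum, Finset.sum_mul]
  rw [← e]
  linarith

end QuadraticForm

/-! ### Lorentzian averages of uniform sums by Fourier methods -/

lemma Real.sinc_sq_le (x : ℝ) : Real.sinc x ^ 2 ≤ (1 + x ^ 2 / 20)⁻¹ := by
  wlog hx : 0 ≤ x generalizing x
  · have := this (-x) (by linarith)
    simpa using this
  rcases hx.eq_or_lt with rfl | hx
  · simp
  rw [Real.sinc_of_ne_zero hx.ne', div_pow, div_le_iff₀ (by positivity), inv_mul_eq_div,
    le_div_iff₀ (by positivity)]
  rcases le_total x 2 with h2 | h2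
  -- `Real.sin_bound` needs an argument of size at most 1, hence the half angle.
  · have hs := Real.sin_bound (x := x / 2) (by rw [abs_le]; constructor <;> linarith)
    have hs0 : 0 < Real.sin (x / 2) := Real.sin_pos_of_pos_of_lt_pi (by linarith)
      (by linarith [Real.pi_gt_three])
    rw [abs_of_pos (half_pos hx)] at hs
    have hs1 := (abs_le.1 hs).2
    set y := x / 2 with hy
    have hxy : x = 2 * y := by rw [hy]; ring
    have hy1 : y ≤ 1 := by linarith
    have hy0 : 0 < y := by linarith
    -- 11/96 = 1/6 - 5/96, the error term 5/96 · y⁴ being absorbed through y⁴ ≤ y³.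
    have h3 : Real.sin y ≤ y * (1 - 11 / 96 * y ^ 2) := by
      have : y ^ 4 ≤ y ^ 3 := pow_le_pow_of_le_one hy0.le hy1 (by norm_num)
      nlinarith
    have h4 : Real.sin y ^ 2 ≤ y ^ 2 * (1 - 11 / 96 * y ^ 2) ^ 2 := by
      rw [← mul_pow]; exact pow_le_pow_left₀ hs0.le h3 2
    have hc : Real.cos y ^ 2 ≤ 1 := Real.cos_sq_le_one y
    rw [hxy, Real.sin_two_mul]
    have h5 : (2 * Real.sin y * Real.cos y) ^ 2 ≤ 4 * (y ^ 2 * (1 - 11 / 96 * y ^ 2) ^ 2) := by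
      nlinarith [sq_nonneg (Real.sin y)]
    have h6 : (1 - 11 / 96 * y ^ 2) ^ 2 * (1 + (2 * y) ^ 2 / 20) ≤ 1 := by
      have hu : y ^ 2 ≤ 1 := pow_le_one₀ hy0.le hy1
      have hu0 : 0 ≤ y ^ 2 := sq_nonneg y
      set u := y ^ 2
      have : (2 * y) ^ 2 = 4 * u := by ring
      rw [this]
      nlinarith [mul_nonneg hu0 hu0, mul_nonneg (mul_nonneg hu0 hu0) (sub_nonneg.2 hu)]
    calc _ ≤ 4 * (y ^ 2 * (1 - 11 / 96 * y ^ 2) ^ 2) * (1 + (2 * y) ^ 2 / 20) := by gcongr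
      _ = (2 * y) ^ 2 * ((1 - 11 / 96 * y ^ 2) ^ 2 * (1 + (2 * y) ^ 2 / 20)) := by ring
      _ ≤ (2 * y) ^ 2 * 1 := by gcongr
      _ = _ := mul_one _
  · have := Real.sin_sq_le_one x
    nlinarith

/-- A product of `sinc` factors decays quadratically when no coefficient dominates. -/
lemma prod_abs_sinc_le {ι : Type*} [Fintype ι] (a : ι → ℝ) {N : ℝ} (hN : 0 < N)
    (hsum : ∑ i, a i ^ 2 = N ^ 2) (ha : ∀ i, a i ^ 2 ≤ N ^ 2 / 2) (t : ℝ) :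
    ∏ i, |Real.sinc (t * a i)| ≤ (1 + (N * t) ^ 2 / 40)⁻¹ := by
  have h0 : 0 < 1 + (N * t) ^ 2 / 40 := by positivity
  -- Bernoulli's inequality with exponents 2 a_i² / N². They are at most 1 because no coefficient
  -- dominates, and they sum to 2, so the product of the `sinc` squares is at most a full inverse
  -- square.
  have h1 : ∀ i, (1 + (N * t) ^ 2 / 40) ^ (2 * a i ^ 2 / N ^ 2) ≤ 1 + (t * a i) ^ 2 / 20 := by
    intro i
    have hp : 2 * a i ^ 2 / N ^ 2 ≤ 1 := by
      rw [div_le_one (by positivity)]; linarith [ha i]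
    refine (rpow_one_add_le_one_add_mul_self (by linarith [h0]) (by positivity) hp).trans_eq ?_
    field_simp
    ring
  have h2 : ∏ i, (1 + (N * t) ^ 2 / 40) ^ (2 * a i ^ 2 / N ^ 2) = (1 + (N * t) ^ 2 / 40) ^ 2 := by
    rw [← Real.rpow_sum_of_pos h0, ← Finset.sum_div, ← Finset.mul_sum, hsum,
      mul_div_cancel_right₀ _ (by positivity)]
    norm_num
  rw [← pow_le_pow_iff_left₀ (Finset.prod_nonneg fun i _ => abs_nonneg _) (by positivity)
    two_ne_zero, ← Finset.prod_pow, inv_pow, ← h2, ← Finset.prod_inv_distrib]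
  refine Finset.prod_le_prod (fun i _ => sq_nonneg _) fun i _ => ?_
  rw [sq_abs]
  refine (Real.sinc_sq_le _).trans ?_
  exact inv_anti₀ (by positivity) (h1 i)

lemma integral_unif_cos (c b : ℝ) :
    ∫ x, Real.cos (c + b * x) ∂(densityMeasure unifDensity) = Real.cos c * Real.sinc b := by
  rw [integral_unif]
  rcases eq_or_ne b 0 with rfl | hb
  · simp
    ring
  · rw [intervalIntegral.integral_comp_add_mul (f := Real.cos) hb, integral_cos,
      Real.sinc_of_ne_zero hb, mul_one, mul_neg_one, Real.sin_add, Real.sin_add,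
      Real.sin_neg, Real.cos_neg, smul_eq_mul]
    field_simp
    ring

lemma isBump_lorentz {τ : ℝ} (hτ : 0 < τ) : IsBump fun x => (τ ^ 2 + x ^ 2)⁻¹ where
  continuous := Continuous.inv₀ (by fun_prop) fun x => by positivity
  nonneg x := by positivity
  anti x y hxy := inv_anti₀ (by positivity) (by have := sq_le_sq.2 hxy; linarith)

lemma inv_add_sq_eq {τ : ℝ} (hτ : 0 < τ) (x : ℝ) :
    (τ ^ 2 + x ^ 2)⁻¹ = (τ ^ 2)⁻¹ * (1 + (τ⁻¹ * x) ^ 2)⁻¹ := by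
  field_simp

lemma integrable_lorentz_affine {τ : ℝ} (hτ : 0 < τ) {b : ℝ} (hb : b ≠ 0) (c : ℝ) :
    Integrable (fun x : ℝ => (τ ^ 2 + (c + b * x) ^ 2)⁻¹) := by
  have h1 : Integrable fun x : ℝ => (τ ^ 2 + x ^ 2)⁻¹ := by
    simp_rw [inv_add_sq_eq hτ]
    exact (integrable_inv_one_add_sq.comp_mul_left' (inv_ne_zero hτ.ne')).const_mul _
  exact (h1.comp_add_left c).comp_mul_left' hb

lemma integral_lorentz_affine {τ : ℝ} (hτ : 0 < τ) (b c : ℝ) :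
    ∫ x : ℝ, (τ ^ 2 + (c + b * x) ^ 2)⁻¹ = |b|⁻¹ * (Real.pi / τ) := by
  rw [Measure.integral_comp_mul_left (fun x => (τ ^ 2 + (c + x) ^ 2)⁻¹) b,
    integral_add_left_eq_self (fun x => (τ ^ 2 + x ^ 2)⁻¹) c, abs_inv, smul_eq_mul]
  congr 1
  simp_rw [inv_add_sq_eq hτ]
  rw [integral_const_mul, Measure.integral_comp_mul_left (fun x => (1 + x ^ 2)⁻¹) τ⁻¹,
    integral_univ_inv_one_add_sq, inv_inv, abs_of_pos hτ, smul_eq_mul]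
  field_simp

lemma integral_unif_lorentz_le {τ : ℝ} (hτ : 0 < τ) {b : ℝ} (hb : b ≠ 0) (c : ℝ) :
    ∫ x, (τ ^ 2 + (c + b * x) ^ 2)⁻¹ ∂(densityMeasure unifDensity)
      ≤ Real.pi / (2 * τ * |b|) := by
  rw [integral_unif, intervalIntegral.integral_of_le (by norm_num)]
  have h := setIntegral_le_integral (s := Ioc (-1 : ℝ) 1) (integrable_lorentz_affine hτ hb c)
    (ae_of_all _ fun x => by simp only [Pi.zero_apply]; positivity)
  rw [integral_lorentz_affine hτ] at h
  have : Real.pi / (2 * τ * |b|) = 1 / 2 * (|b|⁻¹ * (Real.pi / τ)) := by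
    have := abs_pos.2 hb
    field_simp
  rw [this]
  gcongr

/-- A Laplace transform in t, by which the Lorentzian average becomes an integral of the
characteristic function. -/
lemma lorentz_eq_integral {τ : ℝ} (hτ : 0 < τ) (x : ℝ) :
    (τ ^ 2 + x ^ 2)⁻¹ = τ⁻¹ * ∫ t in Ioi (0 : ℝ), Real.exp (-τ * t) * Real.cos (t * x) := by
  have hre : (-τ + x * Complex.I : ℂ).re < 0 := by simpa using hτ
  have h := integral_exp_mul_complex_Ioi hre 0
  have h2 : ∫ t in Ioi (0 : ℝ), Real.exp (-τ * t) * Real.cos (t * x)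
      = (∫ t : ℝ in Ioi 0, Complex.exp ((-τ + x * Complex.I) * t)).re := by
    rw [← RCLike.re_eq_complex_re, ← integral_re (integrableOn_exp_mul_complex_Ioi hre 0)]
    refine integral_congr_ae (ae_of_all _ fun t => ?_)
    simp only [RCLike.re_eq_complex_re, Complex.exp_re]
    simp [mul_comm x t]
  rw [h2, h]
  simp only [Complex.ofReal_zero, mul_zero, Complex.exp_zero, Complex.div_re, Complex.neg_re,
    Complex.one_re, Complex.neg_im, Complex.one_im, Complex.normSq_apply]
  simp
  rw [← sq, ← sq]
  have : τ ^ 2 + x ^ 2 ≠ 0 := by positivity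
  field_simp

section UniformSums

variable {Ω : Type*} [MeasurableSpace Ω] {P : Measure Ω} [IsProbabilityMeasure P]
  {ι : Type*} [DecidableEq ι] {U : ι → Ω → ℝ}

lemma integral_cos_sum_unif (hU : ∀ i, HasLaw (U i) (densityMeasure unifDensity) P)
    (hi : iIndepFun U P) (a : ι → ℝ) (S : Finset ι) :
    ∫ ω, Real.cos (∑ k ∈ S, a k * U k ω) ∂P = ∏ k ∈ S, Real.sinc (a k) := by
  induction S using Finset.induction_on with
  | empty => simp
  | insert i S hiS ih =>
    have := integral_sum_insert hU hi Real.continuous_cos (K := 1) Real.abs_cos_le_one a hiS 0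
    simp only [zero_add] at this
    rw [this]
    simp_rw [integral_unif_cos]
    rw [integral_mul_const, ih, Finset.prod_insert hiS, mul_comm]

variable [Fintype ι]

lemma integral_lorentz_unif_le_of_le (hU : ∀ i, HasLaw (U i) (densityMeasure unifDensity) P)
    (hi : iIndepFun U P) {τ : ℝ} (hτ : 0 < τ) (a : ι → ℝ) {N : ℝ} (hN : 0 < N)
    (hsum : ∑ i, a i ^ 2 = N ^ 2) (ha : ∀ i, a i ^ 2 ≤ N ^ 2 / 2) :
    ∫ ω, (τ ^ 2 + (∑ k, a k * U k ω) ^ 2)⁻¹ ∂P ≤ 10 / (τ * N) := by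
  have hA := aemeasurable_sum_mul (fun i => (hU i).aemeasurable) a Finset.univ
  set A := fun ω => ∑ k, a k * U k ω with hAdef
  have hexp := integrableOn_exp_mul_Ioi (neg_neg_of_pos hτ) 0
  have hc : ∀ t, ∫ ω, Real.exp (-τ * t) * Real.cos (t * A ω) ∂P ≤ (1 + (N * t) ^ 2 / 40)⁻¹
      ∨ t ≤ 0 := by
    intro t
    refine or_iff_not_imp_right.2 fun ht => ?_
    have ht : 0 < t := not_le.1 ht
    have h1 : ∫ ω, Real.cos (t * A ω) ∂P = ∏ i, Real.sinc (t * a i) := by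
      rw [← integral_cos_sum_unif hU hi]
      simp only [hAdef, Finset.mul_sum, mul_assoc]
    rw [integral_const_mul, h1]
    calc Real.exp (-τ * t) * ∏ i, Real.sinc (t * a i)
        ≤ Real.exp (-τ * t) * |∏ i, Real.sinc (t * a i)| := by
          gcongr; exact le_abs_self _
      _ ≤ 1 * |∏ i, Real.sinc (t * a i)| := by
          gcongr
          rw [Real.exp_le_one_iff]
          nlinarith
      _ ≤ _ := by
          rw [one_mul, Finset.abs_prod]
          exact prod_abs_sinc_le a hN hsum ha t
  have hswap : ∫ ω, (τ ^ 2 + A ω ^ 2)⁻¹ ∂P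
      = τ⁻¹ * ∫ t in Ioi (0 : ℝ), ∫ ω, Real.exp (-τ * t) * Real.cos (t * A ω) ∂P := by
    simp_rw [lorentz_eq_integral hτ]
    rw [integral_const_mul, integral_integral_swap]
    refine Integrable.mono' (hexp.comp_snd P) ?_ (ae_of_all _ fun p => ?_)
    · have : AEMeasurable (fun p : Ω × ℝ => A p.1) (P.prod (volume.restrict (Ioi 0))) :=
        hA.comp_fst
      have h2 : AEMeasurable (fun p : Ω × ℝ => Real.exp (-τ * p.2) * Real.cos (p.2 * A p.1))
          (P.prod (volume.restrict (Ioi 0))) := by fun_prop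
      exact h2.aestronglyMeasurable
    · simp only [Function.uncurry]
      rw [norm_mul, Real.norm_of_nonneg (Real.exp_pos _).le]
      exact mul_le_of_le_one_right (Real.exp_pos _).le (Real.abs_cos_le_one _)
  have hscale : ∀ t : ℝ, (1 + (N * t) ^ 2 / 40)⁻¹ = (1 + (N / √40 * t) ^ 2)⁻¹ := by
    intro t
    rw [mul_pow, mul_pow, div_pow, Real.sq_sqrt (by norm_num)]
    ring_nf
  have hN' : 0 < N / √40 := by positivity
  have hI : ∫ t in Ioi (0 : ℝ), (1 + (N * t) ^ 2 / 40)⁻¹ = √40 / N * (Real.pi / 2) := by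
    simp_rw [hscale]
    rw [integral_comp_mul_left_Ioi (fun t => (1 + t ^ 2)⁻¹) 0 hN', mul_zero,
      integral_Ioi_inv_one_add_sq]
    simp
  have hint : IntegrableOn (fun t : ℝ => (1 + (N * t) ^ 2 / 40)⁻¹) (Ioi 0) := by
    simp_rw [hscale]
    exact (integrable_inv_one_add_sq.comp_mul_left' hN'.ne').integrableOn
  have hle : ∫ t in Ioi (0 : ℝ), ∫ ω, Real.exp (-τ * t) * Real.cos (t * A ω) ∂P
      ≤ √40 / N * (Real.pi / 2) := by
    rw [← hI]
    -- Without integrability the left side is 0 by convention.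
    by_cases hint2 : IntegrableOn (fun t => ∫ ω, Real.exp (-τ * t) * Real.cos (t * A ω) ∂P) (Ioi 0)
    · exact setIntegral_mono_on hint2 hint measurableSet_Ioi
        fun t ht => (hc t).resolve_right (not_le.2 ht)
    · rw [integral_undef hint2, hI]
      positivity
  rw [hswap]
  have h40 : √40 ≤ 6.33 := Real.sqrt_le_iff.2 ⟨by norm_num, by norm_num⟩
  have hpi := Real.pi_lt_d2
  -- Source of the constant 10.
  have : √40 * (Real.pi / 2) ≤ 10 := by
    nlinarith [Real.pi_pos, Real.sqrt_nonneg 40]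
  calc _ ≤ τ⁻¹ * (√40 / N * (Real.pi / 2)) := by gcongr
    _ = (√40 * (Real.pi / 2)) / (τ * N) := by field_simp
    _ ≤ _ := by gcongr

lemma integral_lorentz_unif_le (hU : ∀ i, HasLaw (U i) (densityMeasure unifDensity) P)
    (hi : iIndepFun U P) {τ : ℝ} (hτ : 0 < τ) (a : ι → ℝ) {N : ℝ} (hN : 0 < N)
    (hsum : ∑ i, a i ^ 2 = N ^ 2) :
    ∫ ω, (τ ^ 2 + (∑ k, a k * U k ω) ^ 2)⁻¹ ∂P ≤ 10 / (τ * N) := by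
  by_cases ha : ∀ i, a i ^ 2 ≤ N ^ 2 / 2
  · exact integral_lorentz_unif_le_of_le hU hi hτ a hN hsum ha
  push Not at ha
  obtain ⟨i, hai⟩ := ha
  -- One coefficient dominates, and its variable alone is spread enough: given the others, the
  -- integral over [-1, 1] is bounded by the integral over the whole line.
  have hb : N / 2 ≤ |a i| := by
    rw [← abs_of_pos (half_pos hN), ← sq_le_sq]
    nlinarith [sq_nonneg N]
  have hb0 : 0 < |a i| := lt_of_lt_of_le (half_pos hN) hb
  have hbump := isBump_lorentz hτ
  have h := hbump.integral_insert hU hi a (S := Finset.univ.erase i) (i := i) (by simp) 0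
  rw [Finset.insert_erase (Finset.mem_univ i)] at h
  simp only [zero_add] at h
  rw [h]
  calc _ ≤ ∫ _, Real.pi / (2 * τ * |a i|) ∂P := by
        refine integral_mono_of_nonneg (ae_of_all _ fun ω => integral_nonneg fun x => ?_)
          (integrable_const _)
          (ae_of_all _ fun ω => integral_unif_lorentz_le hτ (abs_pos.1 hb0) _)
        simp only [Pi.zero_apply]; positivity
    _ = Real.pi / (2 * τ * |a i|) := by simp
    _ ≤ Real.pi / (2 * τ * (N / 2)) := by gcongr
    _ = Real.pi / (τ * N) := by congr 1; ring
    _ ≤ _ := by gcongr; linarith [Real.pi_le_four]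

end UniformSums

/-! ### Height and variance of symmetric log-concave densities -/

/-- For |x| ≤ |y|, the point x is a convex combination of y and -y, where f takes the same value. -/
lemma IsLogConcave.radiallyAntitone {f : ℝ → ℝ} (hf : IsLogConcave f) (hf0 : ∀ t, 0 ≤ f t)
    (he : Function.Even f) : RadiallyAntitone f := by
  intro x y hxy
  rcases eq_or_ne y 0 with rfl | hy
  · simp only [abs_zero, abs_nonpos_iff] at hxy
    rw [hxy]
  have h1 : |x / y| ≤ 1 := by
    rw [abs_div, div_le_one (abs_pos.2 hy)]; exact hxy
  obtain ⟨h2, h3⟩ := abs_le.1 h1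
  have h := hf y (-y) ((1 + x / y) / 2) ((1 - x / y) / 2) (by linarith) (by linarith) (by ring)
  rw [he y, ← Real.rpow_add_of_nonneg (hf0 y) (by linarith) (by linarith)] at h
  have e1 : (1 + x / y) / 2 + (1 - x / y) / 2 = 1 := by ring
  have e2 : (1 + x / y) / 2 * y + (1 - x / y) / 2 * -y = x := by field_simp; ring
  rwa [e1, e2, Real.rpow_one] at h

section LogConcaveDensity

variable {f : ℝ → ℝ} [IsProbabilityMeasure (densityMeasure f)]

lemma RadiallyAntitone.zero_pos (hf : RadiallyAntitone f) (hf0 : ∀ t, 0 ≤ f t) : 0 < f 0 := by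
  refine lt_of_le_of_ne (hf0 0) fun h => ?_
  have h1 : ∀ x, f x = 0 := fun x => le_antisymm (h ▸ hf.le_zero x) (hf0 x)
  have := integral_density_eq_one hf.measurable hf0
  simp [h1] at this

/-- The interval of half-width t = 1 / f(0) has mass at most 1, and at least 2 t f(t). -/
lemma RadiallyAntitone.apply_inv_le (hf : RadiallyAntitone f) (hf0 : ∀ t, 0 ≤ f t) :
    f (f 0)⁻¹ ≤ f 0 / 2 := by
  have hM := hf.zero_pos hf0
  set t := (f 0)⁻¹ with ht
  have ht0 : 0 < t := inv_pos.2 hM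
  have hint := integrable_density hf.measurable hf0
  have h1 : ∫ x in Icc (-t) t, f t ≤ ∫ x in Icc (-t) t, f x :=
    setIntegral_mono_on (by simp) hint.integrableOn measurableSet_Icc fun x hx =>
      hf _ _ ((abs_le.2 hx).trans (le_abs_self t))
  have h2 := setIntegral_le_integral (s := Icc (-t) t) hint (ae_of_all _ hf0)
  rw [integral_density_eq_one hf.measurable hf0] at h2
  rw [setIntegral_const, Real.volume_real_Icc, max_eq_left (by linarith), smul_eq_mul] at h1
  have h3 : t * f 0 = 1 := inv_mul_cancel₀ hM.ne'
  have h4 : 0 < t := ht0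
  by_contra! h5
  nlinarith

/-- The density has halved by distance 1 / f(0), and log-concavity propagates this drop
geometrically. -/
lemma IsLogConcave.le_exp (hl : IsLogConcave f) (hf0 : ∀ t, 0 ≤ f t) (he : Function.Even f)
    (x : ℝ) : f x ≤ 2 * f 0 * Real.exp (-(f 0 / 2 * |x|)) := by
  have hf := hl.radiallyAntitone hf0 he
  have hM := hf.zero_pos hf0
  set M := f 0 with hMdef
  have hlog2 : 1 / 2 < Real.log 2 := by linarith [Real.log_two_gt_d9]
  rcases le_total (M * |x|) 1 with h | h
  · have h1 : f x ≤ M := hf.le_zero x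
    have h2 : 1 / 2 ≤ Real.exp (-(M / 2 * |x|)) := by
      have := Real.add_one_le_exp (-(M / 2 * |x|))
      linarith
    nlinarith
  · rcases (hf0 x).eq_or_lt with h0 | h0
    · rw [← h0]; positivity
    have hx : 0 < |x| := by
      by_contra! hx
      nlinarith [abs_nonneg x]
    have hfx : f |x| = f x := le_antisymm (hf _ _ (by simp)) (hf _ _ (by simp))
    set p := (M * |x|)⁻¹ with hp
    have hp0 : 0 < p := by positivity
    have hp1 : p ≤ 1 := inv_le_one_of_one_le₀ h
    -- The weight p places 1 / f(0) between 0 and |x|.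
    have hlc := hl |x| 0 p (1 - p) hp0.le (by linarith) (by ring)
    have e : p * |x| + (1 - p) * 0 = M⁻¹ := by rw [hp]; field_simp; ring
    rw [e, hfx] at hlc
    have h1 : f x ^ p * M ^ (1 - p) ≤ M / 2 := hlc.trans (hf.apply_inv_le hf0)
    have h2 := Real.log_le_log (by positivity) h1
    rw [Real.log_mul (by positivity) (by positivity), Real.log_rpow h0, Real.log_rpow hM,
      Real.log_div hM.ne' two_ne_zero] at h2
    have h3 : p * (Real.log (f x) - Real.log M) ≤ -Real.log 2 := by linarith
    have h4 : Real.log (f x) - Real.log M ≤ -Real.log 2 * (M * |x|) := by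
      rw [← div_inv_eq_mul, ← hp, le_div_iff₀ hp0]
      linarith
    have h5 : Real.log (f x) ≤ Real.log M + -(M / 2 * |x|) := by
      have : 0 < M * |x| := by positivity
      nlinarith
    calc f x = Real.exp (Real.log (f x)) := (Real.exp_log h0).symm
      _ ≤ Real.exp (Real.log M + -(M / 2 * |x|)) := Real.exp_le_exp.2 h5
      _ = M * Real.exp (-(M / 2 * |x|)) := by rw [Real.exp_add, Real.exp_log hM]
      _ ≤ _ := by
        have := Real.exp_pos (-(M / 2 * |x|))
        nlinarith [mul_pos hM this]

lemma sq_mul_exp_neg_abs_le (v : ℝ) : v ^ 2 * Real.exp (-|v|) ≤ 48 * (1 + v ^ 2)⁻¹ := by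
  have h2 := Real.pow_div_factorial_le_exp |v| (abs_nonneg v) 2
  have h4 := Real.pow_div_factorial_le_exp |v| (abs_nonneg v) 4
  have e4 : |v| ^ 4 = (v ^ 2) ^ 2 := by rw [← sq_abs v]; ring
  rw [sq_abs] at h2
  rw [e4] at h4
  norm_num [Nat.factorial] at h2 h4
  rw [Real.exp_neg, ← div_eq_mul_inv, ← div_eq_mul_inv,
    div_le_div_iff₀ (Real.exp_pos _) (by positivity)]
  nlinarith [sq_nonneg v]

lemma IsLogConcave.sq_mul_le (hl : IsLogConcave f) (hf0 : ∀ t, 0 ≤ f t) (he : Function.Even f)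
    (x : ℝ) : x ^ 2 * f x ≤ 384 / f 0 * (1 + (f 0 / 2 * x) ^ 2)⁻¹ := by
  have hM := (hl.radiallyAntitone hf0 he).zero_pos hf0
  have h1 := hl.le_exp hf0 he x
  have h2 := sq_mul_exp_neg_abs_le (f 0 / 2 * x)
  rw [abs_mul, abs_of_pos (half_pos hM)] at h2
  calc x ^ 2 * f x ≤ x ^ 2 * (2 * f 0 * Real.exp (-(f 0 / 2 * |x|))) := by gcongr
    _ = 8 / f 0 * ((f 0 / 2 * x) ^ 2 * Real.exp (-(f 0 / 2 * |x|))) := by field_simp; ring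
    _ ≤ 8 / f 0 * (48 * (1 + (f 0 / 2 * x) ^ 2)⁻¹) := by gcongr
    _ = _ := by ring

lemma IsLogConcave.integrable_sq (hl : IsLogConcave f) (hf0 : ∀ t, 0 ≤ f t)
    (he : Function.Even f) : Integrable (fun x => x ^ 2) (densityMeasure f) := by
  have hf := hl.radiallyAntitone hf0 he
  have hM := hf.zero_pos hf0
  have hm := hf.measurable
  rw [integrable_densityMeasure_iff hm hf0]
  refine Integrable.mono' ((integrable_inv_one_add_sq.comp_mul_left' (half_pos hM).ne').const_mul
    (384 / f 0)) (by fun_prop) (ae_of_all _ fun x => ?_)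
  rw [Real.norm_of_nonneg (mul_nonneg (sq_nonneg x) (hf0 x))]
  exact hl.sq_mul_le hf0 he x

lemma IsLogConcave.integral_sq_le (hl : IsLogConcave f) (hf0 : ∀ t, 0 ≤ f t)
    (he : Function.Even f) : ∫ x, x ^ 2 ∂(densityMeasure f) ≤ (60 / f 0) ^ 2 := by
  have hf := hl.radiallyAntitone hf0 he
  have hM := hf.zero_pos hf0
  have hi := hl.integrable_sq hf0 he
  rw [integrable_densityMeasure_iff hf.measurable hf0] at hi
  rw [integral_densityMeasure hf.measurable hf0]
  have h := integral_mono hi ((integrable_inv_one_add_sq.comp_mul_left' (half_pos hM).ne').const_mul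
    (384 / f 0)) (hl.sq_mul_le hf0 he)
  refine h.trans ?_
  rw [integral_const_mul, Measure.integral_comp_mul_left (fun x => (1 + x ^ 2)⁻¹),
    integral_univ_inv_one_add_sq, abs_of_pos (by positivity), smul_eq_mul]
  have : 384 / f 0 * ((f 0 / 2)⁻¹ * Real.pi) = 768 * Real.pi / f 0 ^ 2 := by field_simp; ring
  rw [this, div_pow]
  gcongr
  linarith [Real.pi_le_four]

end LogConcaveDensity

/-! ### An explicit constant for log-concave densities -/

/-- Relative anti-concentration for i.i.d. variables with a bounded symmetric unimodal density. -/
lemma measureReal_abs_sum_le_abs_sum_le {Ω : Type*} [MeasurableSpace Ω] {P : Measure Ω}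
    [IsProbabilityMeasure P] {ι : Type*} [DecidableEq ι] [Fintype ι] {X : ι → Ω → ℝ} {f : ℝ → ℝ}
    [IsProbabilityMeasure (densityMeasure f)] (hf : RadiallyAntitone f) (hf0 : ∀ t, 0 ≤ f t)
    (h2 : Integrable (fun x => x ^ 2) (densityMeasure f))
    (hX : ∀ i, HasLaw (X i) (densityMeasure f) P) (hi : iIndepFun X P) {a b : ι → ℝ} {N τ : ℝ}
    (hN : 0 < N) (hsum : ∑ i, a i ^ 2 = N ^ 2) (hτ : 0 < τ) :
    P.real {ω | |∑ i, a i * X i ω| ≤ |∑ i, b i * X i ω|}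
      ≤ (τ ^ 2 + 2 * (∫ x, x ^ 2 ∂(densityMeasure f)) * ∑ i, b i ^ 2)
        * (20 * f 0 / (τ * N)) := by
  have hM := hf.zero_pos hf0
  set h : ℝ → ℝ := fun x => (τ ^ 2 + x ^ 2)⁻¹ with hdef
  have hh : IsBump h := isBump_lorentz hτ
  have hXm := fun i => (hX i).aemeasurable
  have hA := aemeasurable_sum_mul hXm a Finset.univ
  have hB := aemeasurable_sum_mul hXm b Finset.univ
  set A := fun ω => ∑ i, a i * X i ω with hAdef
  set B := fun ω => ∑ i, b i * X i ω with hBdef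
  have hhA : Integrable (fun ω => h (A ω)) P := hh.integrable_comp hA
  have hB2 : Integrable (fun ω => B ω ^ 2) P := by
    have hL : MemLp B 2 P := by
      refine memLp_finsetSum _ fun i _ => MemLp.const_mul ?_ _
      rw [memLp_two_iff_integrable_sq (hXm i).aestronglyMeasurable]
      exact integrable_comp_of_hasLaw (hX i) h2
    exact hL.integrable_sq
  have hhB : Integrable (fun ω => h (A ω) * B ω ^ 2) P :=
    hB2.bdd_mul (c := h 0) hhA.aestronglyMeasurable (ae_of_all _ fun _ => hh.norm_le _)
  have hE : ∫ ω, h (A ω) ∂P ≤ 20 * f 0 / (τ * N) := by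
    have hU : ∀ i : ι, HasLaw (fun u : ι → ℝ => u i) (densityMeasure unifDensity)
        (Measure.pi fun _ => densityMeasure unifDensity) := fun i =>
      ⟨(measurable_pi_apply i).aemeasurable, (measurePreserving_eval _ i).map_eq⟩
    have hUi : iIndepFun (fun (i : ι) (u : ι → ℝ) => u i)
        (Measure.pi fun _ => densityMeasure unifDensity) :=
      iIndepFun_pi (X := fun _ x => x) fun _ => aemeasurable_id
    have h1 := IsBump.integral_sum_le hf hf0 radiallyAntitone_unifDensity unifDensity_nonneg hX hi
      hU hUi a (fun i => a i / (2 * f 0))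
      -- Comparison with the uniform law divides the coefficients by 2 f(0), which turns 10 / (τ N)
      -- into 20 f(0) / (τ N).
      (fun g hg i => hg.integral_le_unif hf hf0 hM hf.le_zero (a i)) hh Finset.univ
    refine h1.trans ((integral_lorentz_unif_le hU hUi hτ _ (N := N / (2 * f 0)) (by positivity)
      ?_).trans_eq ?_)
    · simp_rw [div_pow]
      rw [← Finset.sum_div, hsum]
    · field_simp
      norm_num
  have hpt : ∀ ω, {ω | |A ω| ≤ |B ω|}.indicator (fun _ => (1 : ℝ)) ω
      ≤ τ ^ 2 * h (A ω) + h (A ω) * B ω ^ 2 := by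
    intro ω
    have hpos : 0 < τ ^ 2 + A ω ^ 2 := by positivity
    have e : τ ^ 2 * h (A ω) + h (A ω) * B ω ^ 2 = (τ ^ 2 + B ω ^ 2) / (τ ^ 2 + A ω ^ 2) := by
      simp only [hdef]; rw [div_eq_mul_inv]; ring
    rw [e]
    by_cases hω : |A ω| ≤ |B ω|
    · rw [indicator_of_mem (by exact hω), one_le_div hpos]
      have := sq_le_sq.2 hω
      linarith
    · rw [indicator_of_notMem (by exact hω)]
      positivity
  have hms : NullMeasurableSet {ω | |A ω| ≤ |B ω|} P :=
    nullMeasurableSet_le hA.norm hB.norm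
  calc P.real {ω | |A ω| ≤ |B ω|}
      = ∫ ω, {ω | |A ω| ≤ |B ω|}.indicator (fun _ => (1 : ℝ)) ω ∂P := by
        rw [integral_indicator₀ hms]
        simp
    _ ≤ ∫ ω, τ ^ 2 * h (A ω) + h (A ω) * B ω ^ 2 ∂P :=
        integral_mono_of_nonneg (ae_of_all _ fun ω => indicator_nonneg (fun _ _ => zero_le_one) ω)
          ((hhA.const_mul _).add hhB) (ae_of_all _ hpt)
    _ = τ ^ 2 * ∫ ω, h (A ω) ∂P + ∫ ω, h (A ω) * B ω ^ 2 ∂P := by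
        rw [integral_add (hhA.const_mul _) hhB, integral_const_mul]
    _ ≤ τ ^ 2 * ∫ ω, h (A ω) ∂P + 2 * (∫ x, x ^ 2 ∂(densityMeasure f)) * (∑ k, b k ^ 2)
        * ∫ ω, h (A ω) ∂P := by
        gcongr
        exact hh.integral_mul_sum_sq_le hf hf0 h2 hX hi a b
    _ = (τ ^ 2 + 2 * (∫ x, x ^ 2 ∂(densityMeasure f)) * ∑ k, b k ^ 2)
        * ∫ ω, h (A ω) ∂P := by ring
    _ ≤ _ := by
        have : 0 ≤ ∫ x, x ^ 2 ∂(densityMeasure f) := integral_nonneg fun x => sq_nonneg x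
        have : 0 ≤ ∑ k, b k ^ 2 := Finset.sum_nonneg fun k _ => sq_nonneg _
        gcongr

lemma isProbabilityMeasure_of_isIIDWithDensity {Ω : Type*} [MeasurableSpace Ω] {P : Measure Ω}
    [IsProbabilityMeasure P] {n : ℕ} {X : Fin n → Ω → ℝ} {f : ℝ → ℝ}
    (h : IsIIDWithDensity P X f) (i : Fin n) : IsProbabilityMeasure (densityMeasure f) := by
  have := Measure.isProbabilityMeasure_map (h.law i).aemeasurable (μ := P)
  rwa [(h.law i).map_eq] at this

lemma EuclideanSpace.exists_index_of_ne_zero {n : ℕ} {α : EuclideanSpace ℝ (Fin n)} (h : α ≠ 0) :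
    ∃ i : Fin n, α i ≠ 0 := by
  by_contra! h0
  exact h (by ext i; simpa using h0 i)

theorem isLogConcaveConstant_3600 : IsLogConcaveConstant.{u} 3600 := by
  intro Ω _ P _ n X f hX he hl α β hα
  obtain ⟨i, -⟩ := EuclideanSpace.exists_index_of_ne_zero hα
  have := isProbabilityMeasure_of_isIIDWithDensity hX i
  have hf0 := hX.nonneg
  have hf := hl.radiallyAntitone hf0 he
  have hM := hf.zero_pos hf0
  have hN : 0 < ‖α‖ := norm_pos_iff.2 hα
  have hkey : ∀ τ : ℝ, 0 < τ → domProb P X α β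
      ≤ (τ ^ 2 + 2 * (60 / f 0 * ‖β‖) ^ 2) * (20 * f 0 / (τ * ‖α‖)) := by
    intro τ hτ
    refine (measureReal_abs_sum_le_abs_sum_le (a := α) (b := β) hf hf0 (hl.integrable_sq hf0 he)
      hX.law hX.indep hN (EuclideanSpace.real_norm_sq_eq α).symm hτ).trans ?_
    rw [← EuclideanSpace.real_norm_sq_eq β, mul_pow, ← mul_assoc]
    gcongr
    exact hl.integral_sq_le hf0 he
  rcases eq_or_ne β 0 with rfl | hβ
  · simp only [norm_zero, zero_div, mul_zero]
    -- For β = 0 there is no optimal τ; the bound tends to 0 with τ.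
    refine le_of_forall_pos_le_add fun ε hε => ?_
    have := hkey (ε * ‖α‖ / (20 * f 0)) (by positivity)
    refine this.trans_eq ?_
    simp only [norm_zero]
    field_simp
    ring
  · have hb : 0 < ‖β‖ := norm_pos_iff.2 hβ
    refine (hkey (60 / f 0 * ‖β‖) (by positivity)).trans_eq ?_
    field_simp
    norm_num

/-! ### Symmetric unimodal laws as scale mixtures of uniforms -/

/-- The mode m need not be 0; when m is not to the left of x, reflection carries the pair to the
increasing side. Nothing is claimed about f(0), so f may be unbounded near 0. -/
lemma IsUnimodal.antitoneOn {f : ℝ → ℝ} (hu : IsUnimodal f) (he : Function.Even f) :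
    AntitoneOn f (Ioi 0) := by
  obtain ⟨m, h1, h2⟩ := hu
  intro x hx y hy hxy
  simp only [mem_Ioi] at hx hy
  by_cases hm : m < x
  · exact h2 hm (hm.trans_le hxy) hxy
  · rw [← he x, ← he y]
    exact h1 (by simp only [mem_Iio]; linarith) (by simp only [mem_Iio]; linarith) (by linarith)

lemma AntitoneOn.aemeasurable_of_even {f : ℝ → ℝ} (ha : AntitoneOn f (Ioi 0))
    (he : Function.Even f) : AEMeasurable f := by
  have h1 : AEMeasurable f (volume.restrict (Ioi 0)) :=
    aemeasurable_restrict_of_antitoneOn measurableSet_Ioi ha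
  have hm : MonotoneOn f (Iio 0) := by
    intro x hx y hy hxy
    simp only [mem_Iio] at hx hy
    rw [← he x, ← he y]
    exact ha (by simp only [mem_Ioi]; linarith) (by simp only [mem_Ioi]; linarith) (by linarith)
  have h2 : AEMeasurable f (volume.restrict (Iio 0)) :=
    aemeasurable_restrict_of_monotoneOn measurableSet_Iio hm
  have h3 := aemeasurable_union_iff.2 ⟨h2, h1⟩
  rwa [Iio_union_Ioi, Measure.restrict_eq_self_of_ae_mem] at h3
  exact compl_mem_ae_iff.2 (by simp)

/-- The half-width of the superlevel set `{x | y < f x}` of an even unimodal function. -/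
noncomputable def levelRadius (f : ℝ → ℝ) (y : ℝ) : ℝ :=
  (volume {x | 0 < x ∧ y < f x}).toReal

lemma measurable_levelRadius (f : ℝ → ℝ) : Measurable (levelRadius f) := by
  have : Antitone fun y => volume {x | 0 < x ∧ y < f x} := fun y z hyz =>
    measure_mono fun x hx => ⟨hx.1, hyz.trans_lt hx.2⟩
  exact this.measurable.ennreal_toReal

lemma levelRadius_nonneg (f : ℝ → ℝ) (y : ℝ) : 0 ≤ levelRadius f y := ENNReal.toReal_nonneg

/-- The law of the level `y` under which `levelRadius f y` is the random scale in the
representation of the density `f` as a mixture of uniform densities. -/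
noncomputable def levelMeasure (f : ℝ → ℝ) : Measure ℝ :=
  (volume.restrict (Ioi 0)).withDensity fun y => ENNReal.ofReal (2 * levelRadius f y)

section Mixture

variable {f : ℝ → ℝ}

/-- Markov's inequality; it excludes the default value 0 of `toReal` at infinity in `levelRadius`
for positive levels. -/
lemma volume_superlevel_lt_top (ha : AntitoneOn f (Ioi 0)) (he : Function.Even f)
    [IsProbabilityMeasure (densityMeasure f)] {y : ℝ} (hy : 0 < y) :
    volume {x | 0 < x ∧ y < f x} < ⊤ := by
  have h1 : ∫⁻ x, ENNReal.ofReal (f x) = 1 := by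
    have := measure_univ (μ := densityMeasure f)
    rwa [densityMeasure, withDensity_apply _ MeasurableSet.univ, Measure.restrict_univ] at this
  have h2 := mul_meas_ge_le_lintegral₀ (ha.aemeasurable_of_even he).ennreal_ofReal
    (ENNReal.ofReal y)
  rw [h1] at h2
  refine (measure_mono (t := {x | ENNReal.ofReal y ≤ ENNReal.ofReal (f x)}) fun x hx =>
    ENNReal.ofReal_le_ofReal hx.2.le).trans_lt ?_
  rw [lt_top_iff_ne_top]
  intro htop
  rw [htop, ENNReal.mul_top (by simpa using hy)] at h2
  simp at h2

lemma le_levelRadius (ha : AntitoneOn f (Ioi 0)) (he : Function.Even f)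
    [IsProbabilityMeasure (densityMeasure f)] {x y : ℝ} (hx : 0 < x) (hy : 0 < y) (hxy : y < f x) :
    x ≤ levelRadius f y := by
  have h : volume (Ioc 0 x) ≤ volume {x | 0 < x ∧ y < f x} :=
    measure_mono fun z hz => ⟨hz.1, hxy.trans_le (ha hz.1 hx hz.2)⟩
  have := ENNReal.toReal_mono (volume_superlevel_lt_top ha he hy).ne h
  rwa [Real.volume_Ioc, sub_zero, ENNReal.toReal_ofReal hx.le] at this

lemma lt_of_lt_levelRadius (ha : AntitoneOn f (Ioi 0)) {x y : ℝ} (hx : 0 < x)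
    (hxy : x < levelRadius f y) : y < f x := by
  by_contra! h
  have h : volume {x | 0 < x ∧ y < f x} ≤ volume (Ioc 0 x) := by
    refine measure_mono fun z hz => ⟨hz.1, ?_⟩
    by_contra! hzx
    exact absurd (hz.2.trans_le (ha hx hz.1 hzx.le)) (not_lt.2 h)
  have := ENNReal.toReal_mono (by simp) h
  rw [Real.volume_Ioc, sub_zero, ENNReal.toReal_ofReal hx.le] at this
  exact absurd hxy (not_lt.2 this)

/-- The exceptional points are 0 and the two endpoints, where the values of f are not controlled. -/
lemma superlevel_ae_eq (ha : AntitoneOn f (Ioi 0)) (he : Function.Even f)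
    [IsProbabilityMeasure (densityMeasure f)] {y : ℝ} (hy : 0 < y) :
    ∀ᵐ x : ℝ, (y < f x ↔ x ∈ Ioo (-levelRadius f y) (levelRadius f y)) := by
  have hne : ∀ c : ℝ, ∀ᵐ x : ℝ, x ≠ c := fun c => by
    filter_upwards [compl_mem_ae_iff.2 (measure_singleton c)] with x hx using hx
  filter_upwards [hne 0, hne (levelRadius f y), hne (-levelRadius f y)] with x h0 h1 h2
  have hfx : f |x| = f x := by
    rcases abs_choice x with h | h <;> rw [h]
    exact he x
  have hx : 0 < |x| := abs_pos.2 h0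
  rw [← hfx, mem_Ioo, ← abs_lt]
  refine ⟨fun h => lt_of_le_of_ne (le_levelRadius ha he hx hy h) fun h3 => ?_,
    fun h => lt_of_lt_levelRadius ha hx h⟩
  rcases abs_choice x with h | h
  · exact h1 (by rw [← h3, h])
  · exact h2 (by rw [← h3, h, neg_neg])

/-- Layer-cake representation of the law with density `f`. -/
lemma lintegral_densityMeasure_eq_layer (ha : AntitoneOn f (Ioi 0)) (he : Function.Even f)
    [IsProbabilityMeasure (densityMeasure f)] {g : ℝ → ENNReal} (hg : Measurable g) :
    ∫⁻ x, g x ∂(densityMeasure f)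
      = ∫⁻ y in Ioi 0, ∫⁻ x in Ioo (-levelRadius f y) (levelRadius f y), g x := by
  have hfm := ha.aemeasurable_of_even he
  rw [densityMeasure, lintegral_withDensity_eq_lintegral_mul₀ hfm.ennreal_ofReal hg.aemeasurable]
  -- f(x) is the length of the levels between 0 and f(x); Tonelli then slices by level.
  have h1 : ∀ x, ENNReal.ofReal (f x) * g x
      = ∫⁻ y in Ioi 0, {p : ℝ × ℝ | p.2 < f p.1}.indicator (fun p => g p.1) (x, y) := by
    intro x
    have : ∀ y, {p : ℝ × ℝ | p.2 < f p.1}.indicator (fun p => g p.1) (x, y)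
        = (Iio (f x)).indicator (fun _ => g x) y := fun y => rfl
    simp_rw [this]
    rw [lintegral_indicator measurableSet_Iio, lintegral_const, Measure.restrict_restrict
      measurableSet_Iio, Measure.restrict_apply_univ, inter_comm, Ioi_inter_Iio, Real.volume_Ioo,
      sub_zero, mul_comm]
  simp only [Pi.mul_apply]
  simp_rw [h1]
  rw [lintegral_lintegral_swap]
  · refine setLIntegral_congr_fun measurableSet_Ioi fun y hy => ?_
    rw [← lintegral_indicator measurableSet_Ioo]
    refine lintegral_congr_ae ?_
    filter_upwards [superlevel_ae_eq ha he hy] with x hx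
    by_cases h : y < f x
    · rw [indicator_of_mem (hx.1 h)]
      exact indicator_of_mem (s := {p : ℝ × ℝ | p.2 < f p.1}) (a := (x, y)) h _
    · rw [indicator_of_notMem fun h' => h (hx.2 h')]
      exact indicator_of_notMem (s := {p : ℝ × ℝ | p.2 < f p.1}) (a := (x, y)) h _
  · have h2 : AEMeasurable (fun p : ℝ × ℝ => g p.1)
      (volume.prod (volume.restrict (Ioi 0))) := (hg.comp measurable_fst).aemeasurable
    refine h2.indicator₀ (nullMeasurableSet_lt measurable_snd.aemeasurable ?_)
    exact hfm.comp_fst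

lemma setLIntegral_Ioo_eq_unif {r : ℝ} (hr : 0 ≤ r) {g : ℝ → ENNReal} (hg : Measurable g) :
    ∫⁻ x in Ioo (-r) r, g x
      = ENNReal.ofReal (2 * r) * ∫⁻ u, g (r * u) ∂(densityMeasure unifDensity) := by
  rcases hr.eq_or_lt with rfl | hr
  · simp
  have hm := radiallyAntitone_unifDensity.measurable
  have hgr : Measurable fun u => g (r * u) := by fun_prop
  have hmul : Measurable fun u : ℝ => r * u := by fun_prop
  have hmap := Real.map_volume_mul_left hr.ne'
  have hvol : (volume : Measure ℝ) = ENNReal.ofReal r • Measure.map (r * ·) volume := by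
    rw [hmap, smul_smul, abs_of_pos (inv_pos.2 hr), ← ENNReal.ofReal_mul hr.le,
      mul_inv_cancel₀ hr.ne']
    simp
  rw [densityMeasure, lintegral_withDensity_eq_lintegral_mul₀ hm.ennreal_ofReal.aemeasurable
    hgr.aemeasurable]
  have h1 : ∫⁻ u, ENNReal.ofReal (unifDensity u) * g (r * u)
      = ENNReal.ofReal (1 / 2) * ∫⁻ u, (Icc (-r) r).indicator g (r * u) := by
    have hind : Measurable fun u => (Icc (-r) r).indicator g (r * u) :=
      (hg.indicator measurableSet_Icc).comp hmul
    rw [← lintegral_const_mul _ hind]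
    refine lintegral_congr fun u => ?_
    have hiff : r * u ∈ Icc (-r) r ↔ |u| ≤ 1 := by
      rw [mem_Icc, ← abs_le, abs_mul, abs_of_pos hr, mul_le_iff_le_one_right hr]
    unfold unifDensity
    by_cases h : |u| ≤ 1
    · rw [if_pos h, indicator_of_mem (hiff.2 h)]
    · rw [if_neg h, indicator_of_notMem fun h' => h (hiff.1 h')]
      simp
  simp only [Pi.mul_apply]
  rw [h1, ← lintegral_map (hg.indicator measurableSet_Icc) hmul, ← mul_assoc,
    ← ENNReal.ofReal_mul (by positivity), mul_one_div, mul_div_cancel_left₀ _ two_ne_zero,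
    ← smul_eq_mul, ← lintegral_smul_measure, ← hvol, lintegral_indicator measurableSet_Icc]
  exact setLIntegral_congr Ioo_ae_eq_Icc

lemma lintegral_levelMeasure {g : ℝ → ENNReal} (hg : Measurable g) :
    ∫⁻ y, g y ∂(levelMeasure f)
      = ∫⁻ y in Ioi 0, ENNReal.ofReal (2 * levelRadius f y) * g y := by
  have := measurable_levelRadius f
  rw [levelMeasure, lintegral_withDensity_eq_lintegral_mul₀ (by fun_prop) hg.aemeasurable]
  rfl

instance : SFinite (levelMeasure f) := by unfold levelMeasure; infer_instance

/-- A symmetric unimodal law is the law of a random scale times an independent uniform variable. -/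
lemma map_levelMeasure_prod_unif (ha : AntitoneOn f (Ioi 0)) (he : Function.Even f)
    [IsProbabilityMeasure (densityMeasure f)] :
    ((levelMeasure f).prod (densityMeasure unifDensity)).map
      (fun p => levelRadius f p.1 * p.2) = densityMeasure f := by
  have hr := measurable_levelRadius f
  have hmeas : Measurable fun p : ℝ × ℝ => levelRadius f p.1 * p.2 := by fun_prop
  refine Measure.ext_of_lintegral _ fun g hg => ?_
  have hg' : Measurable fun p : ℝ × ℝ => g (levelRadius f p.1 * p.2) := hg.comp hmeas
  rw [lintegral_map hg hmeas, lintegral_prod _ hg'.aemeasurable,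
    lintegral_densityMeasure_eq_layer ha he hg]
  rw [lintegral_levelMeasure]
  · refine lintegral_congr fun y => ?_
    exact (setLIntegral_Ioo_eq_unif (levelRadius_nonneg f y) hg).symm
  · exact hg'.lintegral_prod_right'

lemma isProbabilityMeasure_levelMeasure (ha : AntitoneOn f (Ioi 0)) (he : Function.Even f)
    [IsProbabilityMeasure (densityMeasure f)] : IsProbabilityMeasure (levelMeasure f) := by
  have hr := measurable_levelRadius f
  have hmeas : Measurable fun p : ℝ × ℝ => levelRadius f p.1 * p.2 := by fun_prop
  have h := congrArg (fun μ : Measure ℝ => μ univ) (map_levelMeasure_prod_unif ha he)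
  rw [Measure.map_apply hmeas MeasurableSet.univ, preimage_univ, ← univ_prod_univ,
    Measure.prod_prod, measure_univ (μ := densityMeasure unifDensity), mul_one,
    measure_univ (μ := densityMeasure f)] at h
  exact ⟨h⟩

lemma ae_levelRadius_pos : ∀ᵐ y ∂(levelMeasure f), 0 < levelRadius f y := by
  have hr := measurable_levelRadius f
  rw [levelMeasure, ae_withDensity_iff (by fun_prop)]
  refine ae_of_all _ fun y hy => ?_
  rw [ne_eq, ENNReal.ofReal_eq_zero, not_le] at hy
  linarith

lemma lintegral_unif_sq : ∫⁻ u, ENNReal.ofReal (u ^ 2) ∂(densityMeasure unifDensity)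
    = ENNReal.ofReal (1 / 3) := by
  have hi : Integrable (fun u : ℝ => u ^ 2) (densityMeasure unifDensity) := by
    rw [integrable_densityMeasure_iff radiallyAntitone_unifDensity.measurable unifDensity_nonneg,
      unifDensity_eq_indicator]
    have h1 : IntegrableOn (fun u : ℝ => u ^ 2 * (1 / 2)) (Icc (-1) 1) :=
      (Continuous.continuousOn (by fun_prop)).integrableOn_compact isCompact_Icc
    rw [← integrable_indicator_iff measurableSet_Icc] at h1
    refine h1.congr (ae_of_all _ fun u => ?_)
    by_cases hu : u ∈ Icc (-1 : ℝ) 1 <;> simp [hu]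
  rw [← ofReal_integral_eq_lintegral_ofReal hi (ae_of_all _ fun u => sq_nonneg u), integral_unif,
    integral_pow]
  norm_num

/-- E X² = E R² · E U² and E U² = 1/3. -/
lemma lintegral_levelRadius_sq_le (hf0 : ∀ t, 0 ≤ f t) (ha : AntitoneOn f (Ioi 0))
    (he : Function.Even f) [IsProbabilityMeasure (densityMeasure f)]
    (hi : Integrable fun t => t ^ 2 * f t) {B : ℝ} (hB : ∫ t, t ^ 2 * f t ≤ B) :
    ∫⁻ y, ENNReal.ofReal (levelRadius f y ^ 2) ∂(levelMeasure f) ≤ ENNReal.ofReal (3 * B) := by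
  have hr := measurable_levelRadius f
  have hmeas : Measurable fun p : ℝ × ℝ => levelRadius f p.1 * p.2 := by fun_prop
  have h1 : ∫⁻ x, ENNReal.ofReal (x ^ 2) ∂(densityMeasure f) ≤ ENNReal.ofReal B := by
    rw [densityMeasure, lintegral_withDensity_eq_lintegral_mul₀
      (ha.aemeasurable_of_even he).ennreal_ofReal (by fun_prop)]
    refine le_trans (le_of_eq ?_) (ENNReal.ofReal_le_ofReal hB)
    rw [ofReal_integral_eq_lintegral_ofReal hi
      (ae_of_all _ fun t => mul_nonneg (sq_nonneg t) (hf0 t))]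
    refine lintegral_congr fun t => ?_
    simp only [Pi.mul_apply]
    rw [mul_comm, ENNReal.ofReal_mul (sq_nonneg t)]
  rw [← map_levelMeasure_prod_unif ha he, lintegral_map (by fun_prop) hmeas,
    lintegral_prod _ (by fun_prop)] at h1
  simp_rw [mul_pow, ENNReal.ofReal_mul (sq_nonneg _)] at h1
  have h2 : ∀ y, ∫⁻ u, ENNReal.ofReal (levelRadius f y ^ 2) * ENNReal.ofReal (u ^ 2)
      ∂(densityMeasure unifDensity)
      = ENNReal.ofReal (levelRadius f y ^ 2) * ENNReal.ofReal (1 / 3) := fun y => by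
    rw [lintegral_const_mul _ (by fun_prop), lintegral_unif_sq]
  simp_rw [h2] at h1
  rw [lintegral_mul_const _ (by fun_prop)] at h1
  calc _ = ENNReal.ofReal 3 * ((∫⁻ y, ENNReal.ofReal (levelRadius f y ^ 2) ∂(levelMeasure f))
        * ENNReal.ofReal (1 / 3)) := by
        rw [mul_comm, mul_assoc, ← ENNReal.ofReal_mul (by norm_num)]
        norm_num
    _ ≤ ENNReal.ofReal 3 * ENNReal.ofReal B := by gcongr
    _ = _ := by rw [ENNReal.ofReal_mul (by norm_num)]

/-- This is where P(|X| ≤ t) - 2 t f(t) acquires a meaning: it bounds the probability that R < t.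
Levels below f(t) cover all of [-t, t] and account for 2 t f(t); a higher level with R < t
contributes its whole length 2R, the density of the law of R. -/
lemma two_mul_mul_add_levelMeasure_le (ha : AntitoneOn f (Ioi 0))
    (he : Function.Even f) [IsProbabilityMeasure (densityMeasure f)] {t : ℝ} (ht : 0 < t) :
    ENNReal.ofReal (2 * t * f t) + levelMeasure f {y | levelRadius f y < t}
      ≤ densityMeasure f (Icc (-t) t) := by
  have hr := measurable_levelRadius f
  have hset : MeasurableSet {y | levelRadius f y < t} := measurableSet_lt hr measurable_const
  have h1 : densityMeasure f (Icc (-t) t)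
      = ∫⁻ y in Ioi 0, volume (Icc (-t) t ∩ Ioo (-levelRadius f y) (levelRadius f y)) := by
    rw [← lintegral_indicator_one measurableSet_Icc, lintegral_densityMeasure_eq_layer ha he
      (measurable_one.indicator measurableSet_Icc)]
    refine lintegral_congr fun y => ?_
    rw [lintegral_indicator_one measurableSet_Icc, Measure.restrict_apply measurableSet_Icc]
  have h2 : ENNReal.ofReal (2 * t * f t)
      = ∫⁻ y in Ioi 0, (Iio (f t)).indicator (fun _ => ENNReal.ofReal (2 * t)) y := by
    rw [lintegral_indicator measurableSet_Iio, lintegral_const, Measure.restrict_restrict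
      measurableSet_Iio, Measure.restrict_apply_univ, inter_comm, Ioi_inter_Iio, Real.volume_Ioo,
      sub_zero, ENNReal.ofReal_mul (by positivity)]
  have h3 : levelMeasure f {y | levelRadius f y < t}
      = ∫⁻ y in Ioi 0, {y | levelRadius f y < t}.indicator
        (fun y => ENNReal.ofReal (2 * levelRadius f y)) y := by
    rw [levelMeasure, withDensity_apply _ hset, lintegral_indicator hset]
  rw [h1, h2, h3, ← lintegral_add_left (measurable_const.indicator measurableSet_Iio)]
  refine setLIntegral_mono' measurableSet_Ioi fun y hy => ?_
  by_cases hyt : y < f t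
  · have h4 := le_levelRadius ha he ht hy hyt
    rw [indicator_of_mem (by exact hyt), indicator_of_notMem (by exact not_lt.2 h4), add_zero]
    calc ENNReal.ofReal (2 * t) = volume (Ioo (-t) t) := by rw [Real.volume_Ioo]; congr 1; ring
      _ ≤ _ := measure_mono (subset_inter Ioo_subset_Icc_self (Ioo_subset_Ioo (by linarith) h4))
  · rw [indicator_of_notMem (by exact hyt), zero_add]
    by_cases h4 : levelRadius f y < t
    · rw [indicator_of_mem (by exact h4)]
      calc ENNReal.ofReal (2 * levelRadius f y)
          = volume (Ioo (-levelRadius f y) (levelRadius f y)) := by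
            rw [Real.volume_Ioo]; congr 1; ring
        _ ≤ _ := measure_mono (subset_inter
            (Ioo_subset_Icc_self.trans (Icc_subset_Icc (by linarith) h4.le)) le_rfl)
    · rw [indicator_of_notMem (by exact h4)]
      exact zero_le

/-- Layer-cake formula for r⁻² with weight t⁻³ on (r, 1]; for r ≥ 1 the left side is clamped to 0.
-/
lemma ofReal_le_setLIntegral_zpow {r : ℝ} (hr : 0 < r) :
    ENNReal.ofReal (((r ^ 2)⁻¹ - 1) / 2)
      ≤ ∫⁻ t in Ioc (0 : ℝ) 1, (Ioi r).indicator (fun t => ENNReal.ofReal (t ^ (-3 : ℤ))) t := by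
  rcases le_total 1 r with h | h
  · rw [ENNReal.ofReal_of_nonpos]
    · exact zero_le
    · have : (r ^ 2)⁻¹ ≤ 1 := inv_le_one_of_one_le₀ (one_le_pow₀ h)
      linarith
  · have hnot : (0 : ℝ) ∉ uIcc r 1 := by
      rw [uIcc_of_le h]; exact fun h0 => absurd h0.1 (not_le.2 hr)
    have hI : ∫ t in r..1, t ^ (-3 : ℤ) = ((r ^ 2)⁻¹ - 1) / 2 := by
      rw [integral_zpow (Or.inr ⟨by norm_num, hnot⟩)]
      norm_num
      ring
    have hint : IntervalIntegrable (fun t : ℝ => t ^ (-3 : ℤ)) volume r 1 :=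
      intervalIntegral.intervalIntegrable_zpow (Or.inr hnot)
    rw [lintegral_indicator measurableSet_Ioi, Measure.restrict_restrict measurableSet_Ioi,
      ← hI, intervalIntegral.integral_of_le h,
      ofReal_integral_eq_lintegral_ofReal hint.1]
    · refine lintegral_mono_set fun t ht => ⟨ht.1, hr.trans ht.1, ht.2⟩
    · refine (ae_restrict_iff' measurableSet_Ioc).2 (ae_of_all _ fun t ht => ?_)
      have := hr.trans ht.1
      simp only [Pi.zero_apply]
      positivity

/-- By Tonelli, the integral of t⁻³ P(R < t) over (0, 1] is at least half the mean of the positive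
part of R⁻² - 1. -/
lemma lintegral_inv_levelRadius_sq_le (hf0 : ∀ t, 0 ≤ f t) (ha : AntitoneOn f (Ioi 0))
    (he : Function.Even f) [IsProbabilityMeasure (densityMeasure f)]
    (hi : IntegrableOn (fun t => t ^ (-3 : ℤ) *
      ((densityMeasure f).real (Icc (-t) t) - 2 * t * f t)) (Ioc 0 1)) {B : ℝ}
    (hB : ∫ t in Ioc (0 : ℝ) 1, t ^ (-3 : ℤ) *
      ((densityMeasure f).real (Icc (-t) t) - 2 * t * f t) ≤ B) (hB0 : 0 ≤ B) :
    ∫⁻ y, ENNReal.ofReal ((levelRadius f y ^ 2)⁻¹) ∂(levelMeasure f)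
      ≤ ENNReal.ofReal (1 + 2 * B) := by
  have hr := measurable_levelRadius f
  have hprob := isProbabilityMeasure_levelMeasure ha he
  have hpt : ∀ t ∈ Ioc (0 : ℝ) 1, (levelMeasure f).real {y | levelRadius f y < t}
      ≤ (densityMeasure f).real (Icc (-t) t) - 2 * t * f t := by
    intro t ht
    have h := ENNReal.toReal_mono (measure_ne_top _ _) (two_mul_mul_add_levelMeasure_le ha he ht.1)
    rw [ENNReal.toReal_add ENNReal.ofReal_ne_top (measure_ne_top _ _),
      ENNReal.toReal_ofReal (mul_nonneg (by linarith [ht.1]) (hf0 t))] at h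
    simp only [Measure.real]
    linarith
  have h1 : ∫⁻ t in Ioc (0 : ℝ) 1, ENNReal.ofReal (t ^ (-3 : ℤ))
      * levelMeasure f {y | levelRadius f y < t} ≤ ENNReal.ofReal B := by
    refine le_trans ?_ (ENNReal.ofReal_le_ofReal hB)
    rw [ofReal_integral_eq_lintegral_ofReal hi]
    · refine setLIntegral_mono' measurableSet_Ioc fun t ht => ?_
      have ht0 := ht.1
      rw [ENNReal.ofReal_mul (by positivity), ← ofReal_measureReal]
      gcongr
      exact hpt t ht
    · refine (ae_restrict_iff' measurableSet_Ioc).2 (ae_of_all _ fun t ht => ?_)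
      have ht0 := ht.1
      exact mul_nonneg (by positivity) (measureReal_nonneg.trans (hpt t ht))
  have hmz : Measurable fun t : ℝ => ENNReal.ofReal (t ^ (-3 : ℤ)) := by fun_prop
  have h2 : ∫⁻ t in Ioc (0 : ℝ) 1, ENNReal.ofReal (t ^ (-3 : ℤ))
      * levelMeasure f {y | levelRadius f y < t}
      = ∫⁻ y, (∫⁻ t in Ioc (0 : ℝ) 1, (Ioi (levelRadius f y)).indicator
        (fun t => ENNReal.ofReal (t ^ (-3 : ℤ))) t) ∂(levelMeasure f) := by
    rw [lintegral_lintegral_swap]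
    · refine lintegral_congr fun t => ?_
      have hset : MeasurableSet {y | levelRadius f y < t} := measurableSet_lt hr measurable_const
      rw [← lintegral_indicator_one hset, ← lintegral_const_mul _ (measurable_one.indicator hset)]
      refine lintegral_congr fun y => ?_
      by_cases h : levelRadius f y < t
      · rw [indicator_of_mem (by exact h), indicator_of_mem (by exact h)]; simp
      · rw [indicator_of_notMem (by exact h), indicator_of_notMem (by exact h)]; simp
    · have : Function.uncurry (fun y t : ℝ => (Ioi (levelRadius f y)).indicator
          (fun t => ENNReal.ofReal (t ^ (-3 : ℤ))) t)
          = {p : ℝ × ℝ | levelRadius f p.1 < p.2}.indicator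
            (fun p => ENNReal.ofReal (p.2 ^ (-3 : ℤ))) := rfl
      rw [this]
      exact ((hmz.comp measurable_snd).indicator
        (measurableSet_lt (hr.comp measurable_fst) measurable_snd)).aemeasurable
  rw [h2] at h1
  have h3 : ∫⁻ y, ENNReal.ofReal (((levelRadius f y ^ 2)⁻¹ - 1) / 2) ∂(levelMeasure f)
      ≤ ENNReal.ofReal B := by
    refine le_trans (lintegral_mono_ae ?_) h1
    filter_upwards [ae_levelRadius_pos] with y hy
    exact ofReal_le_setLIntegral_zpow hy
  calc ∫⁻ y, ENNReal.ofReal ((levelRadius f y ^ 2)⁻¹) ∂(levelMeasure f)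
      ≤ ∫⁻ y, 1 + 2 * ENNReal.ofReal (((levelRadius f y ^ 2)⁻¹ - 1) / 2) ∂(levelMeasure f) := by
        refine lintegral_mono fun y => ?_
        have e : (levelRadius f y ^ 2)⁻¹ = 1 + 2 * (((levelRadius f y ^ 2)⁻¹ - 1) / 2) := by ring
        nth_rewrite 1 [e]
        refine ENNReal.ofReal_add_le.trans ?_
        rw [ENNReal.ofReal_one, ENNReal.ofReal_mul (by norm_num), ENNReal.ofReal_ofNat]
    _ = 1 + 2 * ∫⁻ y, ENNReal.ofReal (((levelRadius f y ^ 2)⁻¹ - 1) / 2) ∂(levelMeasure f) := by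
        rw [lintegral_add_left measurable_const, lintegral_const_mul _ (by fun_prop)]
        simp
    _ ≤ 1 + 2 * ENNReal.ofReal B := by gcongr
    _ = _ := by
        rw [ENNReal.ofReal_add (by norm_num) (by linarith), ENNReal.ofReal_one,
          ENNReal.ofReal_mul (by norm_num), ENNReal.ofReal_ofNat]

end Mixture

/-! ### Transfer from uniform variables to scale mixtures -/

lemma isLogConcave_unifDensity : IsLogConcave unifDensity := by
  intro x y a b ha hb hab
  by_cases hx : |x| ≤ 1
  · by_cases hy : |y| ≤ 1
    · have hxy : |a * x + b * y| ≤ 1 := by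
        rw [abs_le] at hx hy ⊢
        constructor <;> nlinarith
      simp only [unifDensity, if_pos hx, if_pos hy, if_pos hxy]
      rw [← Real.rpow_add (by norm_num), hab, Real.rpow_one]
    -- A zero weight is separate because 0 ^ 0 = 1.
    · rcases hb.eq_or_lt with rfl | hb
      · obtain rfl : a = 1 := by linarith
        simp
      · simp only [unifDensity, if_neg hy, Real.zero_rpow hb.ne', mul_zero]
        exact unifDensity_nonneg _
  · rcases ha.eq_or_lt with rfl | ha
    · obtain rfl : b = 1 := by linarith
      simp
    · simp only [unifDensity, if_neg hx, Real.zero_rpow ha.ne', zero_mul]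
      exact unifDensity_nonneg _

lemma isIIDWithDensity_unif (n : ℕ) :
    IsIIDWithDensity (Measure.pi fun _ : Fin n => densityMeasure unifDensity)
      (fun i u => u i) unifDensity where
  nonneg := unifDensity_nonneg
  indep := iIndepFun_pi (X := fun _ x => x) fun _ => aemeasurable_id
  law i := ⟨(measurable_pi_apply i).aemeasurable, (measurePreserving_eval _ i).map_eq⟩

lemma IsLogConcaveConstant.domProb_unif_le {C : ℝ} (hC : IsLogConcaveConstant.{0} C) {n : ℕ}
    (α β : EuclideanSpace ℝ (Fin n)) (hα : α ≠ 0) :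
    domProb (Measure.pi fun _ : Fin n => densityMeasure unifDensity) (fun i u => u i) α β
      ≤ C * (‖β‖ / ‖α‖) :=
  hC _ _ n _ unifDensity (isIIDWithDensity_unif n) radiallyAntitone_unifDensity.even
    isLogConcave_unifDensity α β hα

/-- For n = 1 and α = β the norm ratio is 1, so C bounds a probability. -/
lemma IsLogConcaveConstant.nonneg {C : ℝ} (hC : IsLogConcaveConstant.{0} C) : 0 ≤ C := by
  have hα : EuclideanSpace.single (0 : Fin 1) (1 : ℝ) ≠ 0 := by simp
  have h := hC.domProb_unif_le _ (EuclideanSpace.single (0 : Fin 1) (1 : ℝ)) hα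
  have h0 : 0 ≤ domProb (Measure.pi fun _ : Fin 1 => densityMeasure unifDensity)
    (fun i u => u i) (EuclideanSpace.single (0 : Fin 1) (1 : ℝ))
      (EuclideanSpace.single (0 : Fin 1) (1 : ℝ)) := measureReal_nonneg
  simpa using h0.trans h

/-- The ratio of two weighted norms, bounded by the arithmetic-geometric mean inequality and
Jensen's inequality. -/
lemma norm_div_norm_le {n : ℕ} (α β r : Fin n → ℝ) (hα : ∃ i, α i ≠ 0) (hr : ∀ i, 0 < r i) {k : ℝ}
    (hk : 0 < k) :
    ‖WithLp.toLp 2 fun i => β i * r i‖ / ‖WithLp.toLp 2 fun i => α i * r i‖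
      ≤ 1 / 2 * (k * ∑ i, β i ^ 2 * r i ^ 2
        + k⁻¹ * ((∑ i, α i ^ 2) ^ 2)⁻¹ * ∑ i, α i ^ 2 * (r i ^ 2)⁻¹) := by
  have e : ∀ c : Fin n → ℝ, ‖WithLp.toLp 2 fun i => c i * r i‖ ^ 2 = ∑ i, c i ^ 2 * r i ^ 2 := by
    intro c
    rw [EuclideanSpace.real_norm_sq_eq]
    exact Finset.sum_congr rfl fun i _ => mul_pow _ _ _
  obtain ⟨i0, hi0⟩ := hα
  have hpos : ∀ w : Fin n → ℝ, (∀ i, 0 < w i) → 0 < ∑ i, α i ^ 2 * w i := fun w hw =>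
    Finset.sum_pos' (fun i _ => mul_nonneg (sq_nonneg _) (hw i).le)
      ⟨i0, Finset.mem_univ _, mul_pos (by positivity) (hw i0)⟩
  have hS : 0 < ∑ i, α i ^ 2 := by simpa using hpos (fun _ => 1) fun _ => one_pos
  have hR := hpos (fun i => r i ^ 2) fun i => pow_pos (hr i) 2
  -- Cauchy–Schwarz in place of Jensen: it replaces 1 / ‖αr‖² by an expression linear in the r_i⁻².
  have hcs : (∑ i, α i ^ 2) ^ 2 ≤ (∑ i, α i ^ 2 * r i ^ 2) * ∑ i, α i ^ 2 * (r i ^ 2)⁻¹ := by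
    have h := Finset.sum_mul_sq_le_sq_mul_sq Finset.univ (fun i => α i * r i)
      fun i => α i * (r i)⁻¹
    simp only [mul_pow, inv_pow] at h
    refine le_trans (le_of_eq ?_) h
    congr 1
    refine Finset.sum_congr rfl fun i _ => ?_
    have := (hr i).ne'
    field_simp
  rw [← e α] at hcs hR
  rw [← e β]
  set p := ‖WithLp.toLp 2 fun i => β i * r i‖ with hp
  set q := ‖WithLp.toLp 2 fun i => α i * r i‖ with hq
  have hq0 : 0 < q := by
    rcases (norm_nonneg (WithLp.toLp 2 fun i => α i * r i)).eq_or_lt with h | h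
    · rw [hq, ← h] at hR; norm_num at hR
    · exact h
  have h1 : (q ^ 2)⁻¹ ≤ ((∑ i, α i ^ 2) ^ 2)⁻¹ * ∑ i, α i ^ 2 * (r i ^ 2)⁻¹ := by
    rw [inv_mul_eq_div, le_div_iff₀ (by positivity), inv_mul_le_iff₀ hR]
    exact hcs
  have h2 : p / q ≤ 1 / 2 * (k * p ^ 2 + k⁻¹ * (q ^ 2)⁻¹) := by
    have h3 : 0 ≤ k⁻¹ * (k * p - q⁻¹) ^ 2 := by positivity
    have h4 : k⁻¹ * (k * p - q⁻¹) ^ 2 = k * p ^ 2 + k⁻¹ * (q ^ 2)⁻¹ - 2 * (p / q) := by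
      field_simp
      ring
    linarith
  refine h2.trans ?_
  rw [mul_assoc k⁻¹]
  gcongr

section ScaleMixture

variable {n : ℕ} {ρ : Measure ℝ} [IsProbabilityMeasure ρ] {r : ℝ → ℝ}

lemma pi_map_scale_eq (hr : Measurable r) :
    (Measure.pi fun _ : Fin n =>
        (ρ.prod (densityMeasure unifDensity)).map fun p => r p.1 * p.2)
      = ((Measure.pi fun _ : Fin n => ρ).prod
        (Measure.pi fun _ : Fin n => densityMeasure unifDensity)).map
          fun p i => r (p.1 i) * p.2 i := by
  have hψ : Measurable fun p : ℝ × ℝ => r p.1 * p.2 := by fun_prop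
  have hΦ : Measurable fun (p : (Fin n → ℝ) × (Fin n → ℝ)) (i : Fin n) => r (p.1 i) * p.2 i := by
    fun_prop
  have := Measure.isProbabilityMeasure_map (μ := ρ.prod (densityMeasure unifDensity))
    hψ.aemeasurable
  have h := measurePreserving_arrowProdEquivProdArrow ℝ ℝ (Fin n) (fun _ => ρ)
    (fun _ => densityMeasure unifDensity)
  rw [← h.map_eq, Measure.map_map hΦ h.measurable, ← Measure.pi_map_pi fun _ => hψ.aemeasurable]
  rfl

/-- Relative anti-concentration for scale mixtures of uniform variables. -/
lemma IsLogConcaveConstant.measureReal_scale_le {C : ℝ} (hC : IsLogConcaveConstant.{0} C)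
    (hr : Measurable r) (hpos : ∀ᵐ y ∂ρ, 0 < r y) (h2 : Integrable (fun y => r y ^ 2) ρ)
    (hm2 : Integrable (fun y => (r y ^ 2)⁻¹) ρ) (α β : EuclideanSpace ℝ (Fin n)) (hα : α ≠ 0)
    {k : ℝ} (hk : 0 < k) :
    (Measure.pi fun _ : Fin n =>
        (ρ.prod (densityMeasure unifDensity)).map fun p => r p.1 * p.2).real
        {x | |∑ i, α i * x i| ≤ |∑ i, β i * x i|}
      ≤ C * (1 / 2 * (k * ‖β‖ ^ 2 * ∫ y, r y ^ 2 ∂ρ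
        + k⁻¹ * (‖α‖ ^ 2)⁻¹ * ∫ y, (r y ^ 2)⁻¹ ∂ρ)) := by
  have hΦ : Measurable fun (p : (Fin n → ℝ) × (Fin n → ℝ)) (i : Fin n) => r (p.1 i) * p.2 i := by
    fun_prop
  have hS : MeasurableSet {x : Fin n → ℝ | |∑ i, α i * x i| ≤ |∑ i, β i * x i|} :=
    measurableSet_le (by fun_prop) (by fun_prop)
  have hC0 := hC.nonneg
  have hα' := EuclideanSpace.exists_index_of_ne_zero hα
  have hN : 0 < ‖α‖ := norm_pos_iff.2 hα
  set W : (Fin n → ℝ) → ℝ := fun y => C * (1 / 2 * (k * ∑ i, β i ^ 2 * r (y i) ^ 2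
    + k⁻¹ * ((∑ i, α i ^ 2) ^ 2)⁻¹ * ∑ i, α i ^ 2 * (r (y i) ^ 2)⁻¹)) with hW
  have hi2 : ∀ i : Fin n, Integrable (fun y : Fin n → ℝ => r (y i) ^ 2)
      (Measure.pi fun _ => ρ) := fun i =>
    (measurePreserving_eval (fun _ : Fin n => ρ) i).integrable_comp_of_integrable h2
  have him2 : ∀ i : Fin n, Integrable (fun y : Fin n → ℝ => (r (y i) ^ 2)⁻¹)
      (Measure.pi fun _ => ρ) := fun i =>
    (measurePreserving_eval (fun _ : Fin n => ρ) i).integrable_comp_of_integrable hm2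
  have hs2 := integrable_finsetSum Finset.univ fun i (_ : i ∈ Finset.univ) =>
    (hi2 i).const_mul (β i ^ 2)
  have hsm2 := integrable_finsetSum Finset.univ fun i (_ : i ∈ Finset.univ) =>
    (him2 i).const_mul (α i ^ 2)
  have hWi : Integrable W (Measure.pi fun _ => ρ) :=
    (((hs2.const_mul k).add (hsm2.const_mul _)).const_mul _).const_mul _
  have hW0 : ∀ y, 0 ≤ W y := fun y => by
    have h1 : 0 ≤ ∑ i, β i ^ 2 * r (y i) ^ 2 := Finset.sum_nonneg fun i _ => by positivity
    have h3 : 0 ≤ ∑ i, α i ^ 2 * (r (y i) ^ 2)⁻¹ := Finset.sum_nonneg fun i _ => by positivity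
    simp only [hW]
    positivity
  have hWI : ∫ y, W y ∂(Measure.pi fun _ => ρ) = C * (1 / 2 * (k * ‖β‖ ^ 2 * ∫ y, r y ^ 2 ∂ρ
        + k⁻¹ * (‖α‖ ^ 2)⁻¹ * ∫ y, (r y ^ 2)⁻¹ ∂ρ)) := by
    simp only [hW]
    rw [integral_const_mul, integral_const_mul, integral_add (hs2.const_mul k) (hsm2.const_mul _),
      integral_const_mul, integral_const_mul,
      integral_finsetSum _ fun i _ => (hi2 i).const_mul (β i ^ 2),
      integral_finsetSum _ fun i _ => (him2 i).const_mul (α i ^ 2)]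
    simp_rw [integral_const_mul]
    have e1 : ∀ i : Fin n, ∫ y : Fin n → ℝ, r (y i) ^ 2 ∂(Measure.pi fun _ => ρ)
        = ∫ y, r y ^ 2 ∂ρ := fun i =>
      integral_comp_eval (μ := fun _ : Fin n => ρ) (i := i) (f := fun y => r y ^ 2) h2.aestronglyMeasurable
    have e2 : ∀ i : Fin n, ∫ y : Fin n → ℝ, (r (y i) ^ 2)⁻¹ ∂(Measure.pi fun _ => ρ)
        = ∫ y, (r y ^ 2)⁻¹ ∂ρ := fun i =>
      integral_comp_eval (μ := fun _ : Fin n => ρ) (i := i) (f := fun y => (r y ^ 2)⁻¹) hm2.aestronglyMeasurable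
    simp_rw [e1, e2]
    rw [← Finset.sum_mul, ← Finset.sum_mul, ← EuclideanSpace.real_norm_sq_eq,
      ← EuclideanSpace.real_norm_sq_eq]
    congr 2
    field_simp
  have hae : ∀ᵐ y ∂(Measure.pi fun _ : Fin n => ρ), ∀ i, 0 < r (y i) :=
    ae_all_iff.2 fun i => (measurePreserving_eval (fun _ : Fin n => ρ) i).quasiMeasurePreserving.ae
      hpos
  rw [← hWI, pi_map_scale_eq hr, Measure.real, Measure.map_apply hΦ hS,
    Measure.prod_apply (hΦ hS)]
  refine ENNReal.toReal_le_of_le_ofReal (integral_nonneg hW0) ?_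
  rw [ofReal_integral_eq_lintegral_ofReal hWi (ae_of_all _ hW0)]
  refine lintegral_mono_ae ?_
  filter_upwards [hae] with y hy
  have hne : (WithLp.toLp 2 fun i => α i * r (y i) : EuclideanSpace ℝ (Fin n)) ≠ 0 := by
    obtain ⟨i, hi⟩ := hα'
    intro h
    have := congrArg (fun v : EuclideanSpace ℝ (Fin n) => v i) h
    simp [hi, (hy i).ne'] at this
  -- With the scales frozen, they are absorbed into the coefficients of the uniform variables.
  have h := hC.domProb_unif_le _ (WithLp.toLp 2 fun i => β i * r (y i)) hne
  rw [← ofReal_measureReal]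
  refine ENNReal.ofReal_le_ofReal ?_
  refine le_trans (le_of_eq ?_) (h.trans
    (mul_le_mul_of_nonneg_left (norm_div_norm_le α β (fun i => r (y i)) hα' hy hk) hC0))
  simp only [domProb, mul_assoc]
  rfl

end ScaleMixture

lemma integrable_and_integral_le_of_lintegral_le {μ : Measure ℝ} {g : ℝ → ℝ} (hg : Measurable g)
    (hg0 : ∀ y, 0 ≤ g y) {c : ℝ} (hc : 0 ≤ c) (h : ∫⁻ y, ENNReal.ofReal (g y) ∂μ ≤ ENNReal.ofReal c) :
    Integrable g μ ∧ ∫ y, g y ∂μ ≤ c := by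
  refine ⟨⟨hg.aestronglyMeasurable, ?_⟩, ?_⟩
  · rw [hasFiniteIntegral_iff_ofReal (ae_of_all _ hg0)]
    exact h.trans_lt ENNReal.ofReal_lt_top
  · rw [integral_eq_lintegral_of_nonneg_ae (ae_of_all _ hg0) hg.aestronglyMeasurable]
    exact ENNReal.toReal_le_of_le_ofReal hc h

lemma IsLogConcaveConstant.domProb_le {C : ℝ} (hC : IsLogConcaveConstant.{0} C)
    {Ω : Type*} [MeasurableSpace Ω] {P : Measure Ω} [IsProbabilityMeasure P] {n : ℕ}
    {X : Fin n → Ω → ℝ} {f : ℝ → ℝ} {B : ℝ} (hX : IsIIDWithDensity P X f)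
    (he : Function.Even f) (ha : AntitoneOn f (Ioi 0)) [IsProbabilityMeasure (densityMeasure f)]
    (hi : Integrable fun t => t ^ 2 * f t) (hB : ∫ t, t ^ 2 * f t ≤ B)
    (hi' : IntegrableOn (fun t => t ^ (-3 : ℤ) *
      ((densityMeasure f).real (Icc (-t) t) - 2 * t * f t)) (Ioc 0 1))
    (hB' : ∫ t in Ioc (0 : ℝ) 1, t ^ (-3 : ℤ) *
      ((densityMeasure f).real (Icc (-t) t) - 2 * t * f t) ≤ B)
    {α β : EuclideanSpace ℝ (Fin n)} (hα : α ≠ 0) :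
    domProb P X α β ≤ 12 * C * B * (‖β‖ / ‖α‖) := by
  have hf0 := hX.nonneg
  have hr := measurable_levelRadius f
  have hprob := isProbabilityMeasure_levelMeasure ha he
  have hC0 := hC.nonneg
  have hN : 0 < ‖α‖ := norm_pos_iff.2 hα
  have hB0 : 0 ≤ B := (integral_nonneg fun t => mul_nonneg (sq_nonneg t) (hf0 t)).trans hB
  obtain ⟨h2, h2B⟩ := integrable_and_integral_le_of_lintegral_le (hr.pow_const 2)
    (fun y => sq_nonneg _) (by linarith) (lintegral_levelRadius_sq_le hf0 ha he hi hB)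
  obtain ⟨hm2, hm2B⟩ := integrable_and_integral_le_of_lintegral_le
    (show Measurable fun y => (levelRadius f y ^ 2)⁻¹ from (hr.pow_const 2).inv)
    (fun y => inv_nonneg.2 (sq_nonneg _)) (by linarith)
    (lintegral_inv_levelRadius_sq_le hf0 ha he hi' hB' hB0)
  -- From R² + R⁻² ≥ 2 and the two moment bounds, 2 ≤ 3B + (1 + 2B). This lets the additive constant
  -- be absorbed into a multiple of B.
  have hB5 : 1 / 5 ≤ B := by
    have h : ∫ _, (2 : ℝ) ∂(levelMeasure f)
        ≤ ∫ y, levelRadius f y ^ 2 + (levelRadius f y ^ 2)⁻¹ ∂(levelMeasure f) := by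
      refine integral_mono_ae (integrable_const _) (h2.add hm2) ?_
      filter_upwards [ae_levelRadius_pos] with y hy
      have : levelRadius f y ^ 2 + (levelRadius f y ^ 2)⁻¹ - 2
          = (levelRadius f y - (levelRadius f y)⁻¹) ^ 2 := by field_simp; ring
      have h0 := sq_nonneg (levelRadius f y - (levelRadius f y)⁻¹)
      linarith
    rw [integral_add h2 hm2] at h
    simp only [integral_const, probReal_univ, one_smul] at h
    linarith
  have hS : MeasurableSet {x : Fin n → ℝ | |∑ i, α i * x i| ≤ |∑ i, β i * x i|} :=
    measurableSet_le (by fun_prop) (by fun_prop)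
  have hkey : ∀ k : ℝ, 0 < k → domProb P X α β
      ≤ C * (1 / 2 * (k * ‖β‖ ^ 2 * (3 * B) + k⁻¹ * (‖α‖ ^ 2)⁻¹ * (1 + 2 * B))) := by
    intro k hk
    have hXm : ∀ i, AEMeasurable (X i) P := fun i => (hX.law i).aemeasurable
    have hlaw : P.map (fun ω i => X i ω) = Measure.pi fun _ : Fin n => densityMeasure f := by
      rw [(iIndepFun_iff_map_fun_eq_pi_map hXm).1 hX.indep]
      congr 1
      funext i
      exact (hX.law i).map_eq
    have h := hC.measureReal_scale_le hr ae_levelRadius_pos h2 hm2 α β hα hk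
    rw [map_levelMeasure_prod_unif ha he, ← hlaw,
      map_measureReal_apply_of_aemeasurable (aemeasurable_pi_lambda _ hXm) hS] at h
    refine h.trans ?_
    gcongr
  rcases eq_or_ne β 0 with rfl | hβ
  · simp only [norm_zero, zero_div, mul_zero]
    refine le_of_forall_pos_le_add fun ε hε => ?_
    -- For β = 0 only the k⁻¹ term remains, and it vanishes as k grows; C + 1 avoids division by
    -- zero.
    have hk : 0 < (C + 1) * (1 + 2 * B) / (‖α‖ ^ 2 * ε) := by positivity
    refine (hkey _ hk).trans ?_
    simp only [norm_zero]
    have e : C * (1 / 2 * ((C + 1) * (1 + 2 * B) / (‖α‖ ^ 2 * ε) * 0 ^ 2 * (3 * B)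
        + ((C + 1) * (1 + 2 * B) / (‖α‖ ^ 2 * ε))⁻¹ * (‖α‖ ^ 2)⁻¹ * (1 + 2 * B)))
        = C / (C + 1) * (ε / 2) := by
      field_simp
      ring
    rw [e, zero_add]
    have : C / (C + 1) ≤ 1 := (div_le_one (by linarith)).2 (by linarith)
    nlinarith
  · have hb : 0 < ‖β‖ := norm_pos_iff.2 hβ
    -- This k gives 3B + (1 + 2B)/4 times C‖β‖/‖α‖, well within 12B since B ≥ 1/5.
    refine (hkey (2 / (‖α‖ * ‖β‖)) (by positivity)).trans ?_
    have e : C * (1 / 2 * (2 / (‖α‖ * ‖β‖) * ‖β‖ ^ 2 * (3 * B)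
        + (2 / (‖α‖ * ‖β‖))⁻¹ * (‖α‖ ^ 2)⁻¹ * (1 + 2 * B)))
        = C * (‖β‖ / ‖α‖) * (7 / 2 * B + 1 / 4) := by
      field_simp
      ring
    rw [e]
    have : 12 * C * B * (‖β‖ / ‖α‖) = C * (‖β‖ / ‖α‖) * (12 * B) := by ring
    rw [this]
    gcongr
    linarith

/-- Universe 0 suffices for the hypothesis on C, since it is applied only to uniform variables on
`Fin n → ℝ`. -/
theorem mainTheorem6 :
    (∃ C : ℝ, IsLogConcaveConstant.{u} C) ∧
    ∀ C : ℝ, IsLogConcaveConstant.{0} C →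
      ∀ (Ω : Type u) [MeasurableSpace Ω] (P : Measure Ω) [IsProbabilityMeasure P] (n : ℕ)
        (X : Fin n → Ω → ℝ) (f : ℝ → ℝ) (B : ℝ),
        IsIIDWithDensity P X f → Function.Even f → IsUnimodal f →
        Integrable (fun t => t ^ 2 * f t) → ∫ t, t ^ 2 * f t ≤ B →
        (∀ i, IntegrableOn
          (fun t => t ^ (-3 : ℤ) * (P.real {ω | |X i ω| ≤ t} - 2 * t * f t)) (Ioc 0 1)) →
        (∀ i, ∫ t in Ioc (0 : ℝ) 1,
          t ^ (-3 : ℤ) * (P.real {ω | |X i ω| ≤ t} - 2 * t * f t) ≤ B) →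
        ∀ α β : EuclideanSpace ℝ (Fin n), α ≠ 0 →
          domProb P X α β ≤ 12 * C * B * (‖β‖ / ‖α‖) := by
  refine ⟨⟨3600, isLogConcaveConstant_3600⟩, ?_⟩
  intro C hC Ω _ P _ n X f B hX he hu hi hB hi' hB' α β hα
  -- α ≠ 0 forces n ≥ 1; a coordinate is needed to know that f has total mass 1.
  obtain ⟨i, -⟩ := EuclideanSpace.exists_index_of_ne_zero hα
  have := isProbabilityMeasure_of_isIIDWithDensity hX i
  have hP : ∀ t, P.real {ω | |X i ω| ≤ t} = (densityMeasure f).real (Icc (-t) t) := by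
    intro t
    have h := (hX.law i).measureReal_eq (p := fun x => |x| ≤ t)
      (measurableSet_le measurable_abs measurable_const)
    rw [h]
    congr 1
    ext x
    simp only [mem_ofPred_eq, mem_Icc, abs_le]
  specialize hi' i
  specialize hB' i
  simp only [hP] at hi' hB'
  exact hC.domProb_le hX he (hu.antitoneOn he) hi hB hi' hB' hα
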